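/- \textbf{Setting.} Let $\lambda>0$, $P_t>0$, and let $X_1,\dots,X_U\in\mathbb R^3$ be the user locations. Put $r_u=|X_u|$. For an azimuth $\varphi$ and a polar angle $\theta\in[0,\pi]$ let $s(\varphi,\theta)=(\sin\theta\cos\varphi,\sin\theta\sin\varphi,\cos\theta)$. The spherical array of radius $r_0$ is $\{r_0 s(\varphi,\theta)\}$. The channel between $X_u$ and an array element $A$ is $h_u(A)=\frac{1}{\sqrt{4\pi}\,|X_u-A|}e^{-j\frac{2\pi}{\lambda}|X_u-A|}$. For $\ell\ge 0$ and $-\ell\le m\le \ell$ let $$Y_\ell^m(\varphi,\theta)=\sqrt{\tfrac{2\ell+1}{4\pi}\tfrac{(\ell-m)!}{(\ell+m)!}}\;P_\ell^m(\cos\theta)e^{jm\varphi},\qquad P_\ell^m(x)=\tfrac{(-1)^m}{2^\ell \ell!}(1-x^2)^{m/2}\tfrac{d^{m+\ell}}{dx^{m+\ell}}(x^2-1)^\ell,$$ where $P_\ell^m(\pm1)$ is understood by continuity, and let $J_\nu$ be the Bessel function of the first kind. Fix $M\ge 0$. The multiuser phase mode (MU-PM) precoder of user $u$ with coefficients $c_u=(c_{u,m,\ell})_{0\le\ell\le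 M,\,-\ell\le m\le\ell}$ is $f_u=\frac{\overline{h_u}}{|h_u|}\sum_{\ell=0}^M\sum_{m=-\ell}^{\ell}c_{u,m,\ell}Y_\ell^m$. The data symbol of user $k$ enters the signal received at user $u$ with the coefficient $$G_{u,k}(r_0)=\frac{\lambda}{\sqrt{4\pi}}\sqrt{\frac{P_t}{4\pi r_0^2}}\int_0^{2\pi}\!\!\int_0^{\pi}h_u f_k\; r_0^2\sin\theta\,d\theta\,d\varphi .$$ The coupling coefficients are $$\mathcal J_{u,k,m,\ell}=\int_0^{2\pi}\!\!\int_0^\pi e^{j\frac{2\pi}{\lambda}(r_u\cos\psi_u-r_k\cos\psi_k)}\,Y_\ell^m(\varphi,\theta)\sin\theta\,d\theta\,d\varphi,$$ where $\psi_u$ is the angle between $X_u$ and $s(\varphi,\theta)$. Let $\tilde{\mathcal J}_u$ be the matrix whose rows are indexed by the users $k\ne u$, whose columns are indexed by the pairs $(\ell,m)$ with $0\le\ell\le M$ and $-\ell\le m\le\ell$, and whose entries are $\mathcal J_{k,u,m,\ell}$ (the couplings of the modes of user $u$ into user $k$). The coefficients $c_u$ satisfy the zero-forcing constraints if $\sum_{\ell=0}^M\sum_{m=-\ell}^{\ell}c_{u,m,\ell}\,\mathcal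 J_{k,u,m,\ell}=0$ for all $k\neq u$. \textbf{Theorem (multiuser UA precoding, spherical array).} (1) For all users $u,k$, all $\ell\ge0$ and $-\ell\le m\le\ell$: if $X_u\ne X_k$ and $(\varphi_{u,k},\theta_{u,k})$, with $\theta_{u,k}\in[0,\pi]$, are the angles of the direction of $X_u-X_k$, then $$\mathcal J_{u,k,m,\ell}=\frac{(2\pi)^{3/2}j^\ell J_{\ell+\frac12}\!\left(\frac{2\pi}{\lambda}|X_u-X_k|\right)}{\sqrt{\frac{2\pi}{\lambda}|X_u-X_k|}}\;Y_\ell^m(\varphi_{u,k},\theta_{u,k}).$$ If $X_u=X_k$ (in particular if $u=k$), then $\mathcal J_{u,k,m,\ell}=\sqrt{4\pi}$ for $\ell=0$ and $\mathcal J_{u,k,m,\ell}=0$ for $\ell\ge1$. (2) For all users $u,k$ and all fixed coefficients $c_k$, as $r_0\to\infty$, $$G_{u,k}(r_0)=\lambda\sqrt{\tfrac{P_t}{4\pi}}\,\tfrac1{4\pi}\sum_{\ell=0}^M\sum_{m=-\ell}^{\ell}c_{k,m,\ell}\,\mathcal J_{u,k,m,\ell}+O\!\left(\max_v r_v/r_0\right).$$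 (3) For every user $u$, the coefficients $c_u$ that satisfy the zero-forcing constraints are exactly the elements of $\mathrm{null}(\tilde{\mathcal J}_u)$. Equivalently, $c_u\in\mathrm{null}(\tilde{\mathcal J}_u)$ if and only if the interference that the stream of user $u$ causes at every other user is of lower order: $G_{k,u}(r_0)=O(\max_v r_v/r_0)$ as $r_0\to\infty$ for all $k\ne u$. -/

import Mathlib

noncomputable section

namespace UbiquitousArray

/-- Three-dimensional Euclidean space. -/
abbrev Space := EuclideanSpace ℝ (Fin 3)

/-- The Bessel function of the first kind of real order `ν`, by its power series
`J_ν(x) = ∑ k, (-1)^k / (k! Γ(k + ν + 1)) (x/2)^(2k + ν)`. -/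
def besselJ (ν x : ℝ) : ℝ :=
  ∑' k : ℕ, (-1 : ℝ) ^ k / ((Nat.factorial k : ℝ) * Real.Gamma ((k : ℝ) + ν + 1)) *
    (x / 2) ^ (2 * (k : ℝ) + ν)

/-- The associated Legendre function
`P_ℓ^m(x) = (-1)^m / (2^ℓ ℓ!) (1 - x²)^(m/2) d^(m+ℓ)/dx^(m+ℓ) (x² - 1)^ℓ` for `-ℓ ≤ m ≤ ℓ` and
`-1 ≤ x ≤ 1`. At `x = ± 1` the power `0 ^ (m/2)` is `0` for `m ≠ 0` and `1` for `m = 0`, which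
gives the values by continuity, for negative `m` too. -/
def assocLegendre (ℓ : ℕ) (m : ℤ) (x : ℝ) : ℝ :=
  (-1 : ℝ) ^ m / (2 ^ ℓ * (Nat.factorial ℓ : ℝ)) * (1 - x ^ 2) ^ ((m : ℝ) / 2) *
    (Polynomial.derivative^[(m + ℓ).toNat]
      ((Polynomial.X ^ 2 - 1 : Polynomial ℝ) ^ ℓ)).eval x

/-- The orthonormal spherical harmonic `Y_ℓ^m(φ, θ)`, `-ℓ ≤ m ≤ ℓ`, with azimuth `φ` and
polar angle `θ ∈ [0, π]`. -/
def sphericalHarmonic (ℓ : ℕ) (m : ℤ) (φ θ : ℝ) : ℂ :=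
  (Real.sqrt ((2 * (ℓ : ℝ) + 1) / (4 * Real.pi) *
      ((Nat.factorial (ℓ - m).toNat : ℝ) / (Nat.factorial (ℓ + m).toNat : ℝ))) *
    assocLegendre ℓ m (Real.cos θ) : ℝ) * Complex.exp (Complex.I * m * φ)

/-- The unit vector with azimuth `φ` and polar angle `θ`. -/
def dir (φ θ : ℝ) : Space :=
  !₂[Real.sin θ * Real.cos φ, Real.sin θ * Real.sin φ, Real.cos θ]

/-- The integral of `F` over the unit sphere in spherical coordinates. -/
def sphereIntegral (F : ℝ → ℝ → ℂ) : ℂ :=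
  ∫ φ in (0 : ℝ)..(2 * Real.pi), ∫ θ in (0 : ℝ)..Real.pi, F φ θ * (Real.sin θ : ℂ)

/-- The free-space channel response between the points `x` and `a` at wavelength `lam`. -/
def channel (lam : ℝ) (x a : Space) : ℂ :=
  1 / ((Real.sqrt (4 * Real.pi) * ‖x - a‖ : ℝ) : ℂ) *
    Complex.exp (-Complex.I * ((2 * Real.pi / lam * ‖x - a‖ : ℝ) : ℂ))

/-- The channel-conjugate precoder that targets a user at `x`, at the array element `a`. -/
def conjPrecoder (lam : ℝ) (x a : Space) : ℂ :=
  (starRingEnd ℂ) (channel lam x a) / (‖channel lam x a‖ : ℂ)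

/-- The indices `(ℓ, m)` with `0 ≤ ℓ ≤ M` and `-ℓ ≤ m ≤ ℓ` of the phase modes in use. -/
abbrev ModeIndex (M : ℕ) :=
  Σ ℓ : Fin (M + 1), ↥(Finset.Icc (-((ℓ : ℕ) : ℤ)) ((ℓ : ℕ) : ℤ))

/-- The multiuser phase mode precoder with coefficients `c` for a user at `x`, at the element of
the spherical array of radius `r₀` in the direction `(φ, θ)`. -/
def phaseModePrecoder {M : ℕ} (lam : ℝ) (x : Space) (c : ModeIndex M → ℂ) (r₀ φ θ : ℝ) : ℂ :=
  conjPrecoder lam x (r₀ • dir φ θ) *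
    ∑ ℓ : Fin (M + 1), ∑ m : ↥(Finset.Icc (-((ℓ : ℕ) : ℤ)) ((ℓ : ℕ) : ℤ)),
      c ⟨ℓ, m⟩ * sphericalHarmonic ℓ m φ θ

/-- The coefficient with which the data symbol of a user at `y`, precoded with the multiuser phase
mode precoder with coefficients `c`, enters the signal received by a user at `x`, for transmission
power `Pt` per user, the spherical array of radius `r₀`, and the receive aperture `lam²/(4π)`. -/
def streamGain {M : ℕ} (lam Pt : ℝ) (x y : Space) (c : ModeIndex M → ℂ) (r₀ : ℝ) : ℂ :=
  ((lam / Real.sqrt (4 * Real.pi) * Real.sqrt (Pt / (4 * Real.pi * r₀ ^ 2)) : ℝ) : ℂ) *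
    sphereIntegral (fun φ θ =>
      channel lam x (r₀ • dir φ θ) * phaseModePrecoder lam y c r₀ φ θ * ((r₀ ^ 2 : ℝ) : ℂ))

/-- The coupling coefficient `𝒥_{u,k,m,ℓ}` for users at the points `X u`: the integral over the
unit sphere of `exp(j (2π/λ) (r_u cos ψ_u - r_k cos ψ_k)) Y_ℓ^m`, where `r_u = |X u|` and `ψ_u` is
the angle between `X u` and the integration direction. -/
def coupling {U : ℕ} (lam : ℝ) (X : Fin U → Space) (u k : Fin U) (m : ℤ) (ℓ : ℕ) : ℂ :=
  sphereIntegral (fun φ θ =>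
    Complex.exp (Complex.I * ((2 * Real.pi / lam *
      (‖X u‖ * Real.cos (InnerProductGeometry.angle (X u) (dir φ θ)) -
        ‖X k‖ * Real.cos (InnerProductGeometry.angle (X k) (dir φ θ))) : ℝ) : ℂ)) *
      sphericalHarmonic ℓ m φ θ)

/-- The block of degree `ℓ` of the coupling matrix of user `u`. Its rows are indexed by the other
users `k`, and its entries are the coefficients `𝒥_{k,u,m,ℓ}` with which the modes of user `u`
reach user `k`. -/
def couplingBlock {U : ℕ} (lam : ℝ) (X : Fin U → Space) (u : Fin U) (ℓ : ℕ) :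
    Matrix {k : Fin U // k ≠ u} ↥(Finset.Icc (-(ℓ : ℤ)) (ℓ : ℤ)) ℂ :=
  Matrix.of fun k m => coupling lam X k u m ℓ

/-- The coupling matrix of user `u`: the blocks of degrees `0, …, M` side by side. -/
def couplingMatrix {U : ℕ} (M : ℕ) (lam : ℝ) (X : Fin U → Space) (u : Fin U) :
    Matrix {k : Fin U // k ≠ u} (ModeIndex M) ℂ :=
  Matrix.of fun k i => couplingBlock lam X u i.1 k i.2

/-- The zero-forcing constraints on the coefficients `c` of user `u`: at every other user `k`
the couplings of the modes of user `u` add up to zero. -/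
def ZeroForcing {U M : ℕ} (lam : ℝ) (X : Fin U → Space) (u : Fin U) (c : ModeIndex M → ℂ) : Prop :=
  ∀ k : Fin U, k ≠ u →
    ∑ ℓ : Fin (M + 1), ∑ m : ↥(Finset.Icc (-((ℓ : ℕ) : ℤ)) ((ℓ : ℕ) : ℤ)),
      c ⟨ℓ, m⟩ * coupling lam X k u m ℓ = 0

end UbiquitousArray

end

open Asymptotics UbiquitousArray

/-! Closed form. Since `‖x‖ cos ψ` is an inner product with the unit direction `s`, a coupling is
the integral of a plane wave `exp(i a v·s)` against `Y_ℓ^m`, with `a v` the scaled difference of the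
two user positions. The plane wave expansion evaluates it as `4π i^ℓ j_ℓ(a) Y_ℓ^m(v)`. To prove the
expansion, all harmonics of degree `ℓ` are treated at once: for the isotropic vector `nullVector t`,
the power `(w·s)^ℓ` is a polynomial in `t` whose coefficients are multiples of the `Y_ℓ^m`
(`dirForm_nullVector_pow`, `sphericalHarmonic_eq_coeff`). The moments of `(z·s)^N` for complex `z`
are computed explicitly and polarized along `z + t w`; isotropy of `w` leaves a single term in each
mixed moment (`sphereIntegral_mixed_add`). Summing the exponential series gives
`sphereIntegral_isotropic_mul_exp`, and comparing powers of `t` gives the expansion. Finally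
`besselJ_half_int_eq` identifies `j_ℓ` with the half-integer Bessel function.

Large array. The distance from `x` to the array element in direction `s` is `r - x·s + O(1/r)`,
uniformly in `s`. Hence the normalized integrand differs from the far-field one by `O(R/r)`, and the
far-field integral is the sum of couplings (`streamGain_sub_isBigO`).

Zero forcing. The leading term does not depend on `r` and has a nonzero prefactor, so the gain is
`O(R/r)` exactly when the sum of couplings vanishes, which is the kernel condition. -/

namespace UbiquitousArray

open Filter Topology

/-! ### Integration over the sphere in polar coordinates. -/

lemma continuous_integral_polar {F : ℝ → ℝ → ℂ} (hF : Continuous (Function.uncurry F)) :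
    Continuous fun φ => ∫ θ in (0 : ℝ)..Real.pi, F φ θ * (Real.sin θ : ℂ) := by
  apply intervalIntegral.continuous_parametric_intervalIntegral_of_continuous'
  have h : Continuous fun p : ℝ × ℝ => F p.1 p.2 := hF
  simp only [Function.uncurry_def]
  fun_prop

lemma intervalIntegrable_polar {F : ℝ → ℝ → ℂ} (hF : Continuous (Function.uncurry F)) (φ : ℝ) :
    IntervalIntegrable (fun θ => F φ θ * (Real.sin θ : ℂ)) MeasureTheory.volume 0 Real.pi := by
  have h : Continuous fun θ => F φ θ := hF.comp (Continuous.prodMk_right φ)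
  apply Continuous.intervalIntegrable
  fun_prop

lemma sphereIntegral_sub {F G : ℝ → ℝ → ℂ} (hF : Continuous (Function.uncurry F))
    (hG : Continuous (Function.uncurry G)) :
    sphereIntegral (fun φ θ => F φ θ - G φ θ) = sphereIntegral F - sphereIntegral G := by
  unfold sphereIntegral
  rw [← intervalIntegral.integral_sub
    ((continuous_integral_polar hF).intervalIntegrable _ _)
    ((continuous_integral_polar hG).intervalIntegrable _ _)]
  congr 1
  ext φ
  rw [← intervalIntegral.integral_sub (intervalIntegrable_polar hF φ)
    (intervalIntegrable_polar hG φ)]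
  simp only [sub_mul]

lemma sphereIntegral_const_mul (c : ℂ) (F : ℝ → ℝ → ℂ) :
    sphereIntegral (fun φ θ => c * F φ θ) = c * sphereIntegral F := by
  unfold sphereIntegral
  simp only [mul_assoc, intervalIntegral.integral_const_mul]

lemma sphereIntegral_finsetSum {ι : Type*} (s : Finset ι) {F : ι → ℝ → ℝ → ℂ}
    (hF : ∀ i ∈ s, Continuous (Function.uncurry (F i))) :
    sphereIntegral (fun φ θ => ∑ i ∈ s, F i φ θ) = ∑ i ∈ s, sphereIntegral (F i) := by
  unfold sphereIntegral
  rw [← intervalIntegral.integral_finsetSum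
    fun i hi => (continuous_integral_polar (hF i hi)).intervalIntegrable _ _]
  congr 1
  ext φ
  rw [← intervalIntegral.integral_finsetSum fun i hi => intervalIntegrable_polar (hF i hi) φ]
  simp only [Finset.sum_mul]

lemma sphereIntegral_congr {F G : ℝ → ℝ → ℂ}
    (h : ∀ φ, ∀ θ ∈ Set.Icc 0 Real.pi, F φ θ = G φ θ) : sphereIntegral F = sphereIntegral G := by
  unfold sphereIntegral
  congr 1
  ext φ
  apply intervalIntegral.integral_congr
  intro θ hθ
  rw [Set.uIcc_of_le Real.pi_pos.le] at hθ
  simp only [h φ θ hθ]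

/-- Bounding `sin θ` by 1 costs a factor: `2π²` replaces the area `4π`. Only finiteness of the
constant matters later. -/
lemma norm_sphereIntegral_le {F : ℝ → ℝ → ℂ} {C : ℝ}
    (h : ∀ φ ∈ Set.Icc 0 (2 * Real.pi), ∀ θ ∈ Set.Icc 0 Real.pi, ‖F φ θ‖ ≤ C) :
    ‖sphereIntegral F‖ ≤ C * (2 * Real.pi ^ 2) := by
  have hC : 0 ≤ C :=
    (norm_nonneg _).trans (h 0 ⟨le_rfl, Real.two_pi_pos.le⟩ 0 ⟨le_rfl, Real.pi_pos.le⟩)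
  have h1 : ∀ φ ∈ Set.Icc 0 (2 * Real.pi),
      ‖∫ θ in (0 : ℝ)..Real.pi, F φ θ * (Real.sin θ : ℂ)‖ ≤ C * Real.pi := by
    intro φ hφ
    refine (intervalIntegral.norm_integral_le_of_norm_le_const (C := C) ?_).trans_eq ?_
    · intro θ hθ
      rw [Set.uIoc_of_le Real.pi_pos.le] at hθ
      rw [norm_mul, Complex.norm_real, Real.norm_eq_abs]
      exact (mul_le_mul (h φ hφ θ ⟨hθ.1.le, hθ.2⟩) (Real.abs_sin_le_one θ) (abs_nonneg _)
        hC).trans_eq (mul_one C)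
    · rw [sub_zero, abs_of_pos Real.pi_pos]
  refine (intervalIntegral.norm_integral_le_of_norm_le_const (C := C * Real.pi)
    fun φ hφ => h1 φ ?_).trans_eq ?_
  · rw [Set.uIoc_of_le Real.two_pi_pos.le] at hφ
    exact ⟨hφ.1.le, hφ.2⟩
  · rw [sub_zero, abs_of_pos (by positivity)]
    ring

/-! ### Moments of a complex linear form on the sphere. -/

/-- The complex bilinear pairing of a vector with the unit vector `dir φ θ`. -/
noncomputable def dirForm (z : Fin 3 → ℂ) (φ θ : ℝ) : ℂ :=
  z 0 * (Real.sin θ * Real.cos φ) + z 1 * (Real.sin θ * Real.sin φ) + z 2 * Real.cos θ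

lemma continuous_dirForm (z : Fin 3 → ℂ) : Continuous (Function.uncurry (dirForm z)) := by
  simp only [Function.uncurry_def, dirForm]
  fun_prop

@[fun_prop]
lemma continuous_dirForm' (z : Fin 3 → ℂ) : Continuous fun p : ℝ × ℝ => dirForm z p.1 p.2 :=
  continuous_dirForm z

lemma integral_exp_int_mul_I (n : ℤ) :
    ∫ φ in (0 : ℝ)..(2 * Real.pi), Complex.exp (n * φ * Complex.I) =
      if n = 0 then 2 * (Real.pi : ℂ) else 0 := by
  split_ifs with h
  · simp [h]
  · have hc : (n * Complex.I : ℂ) ≠ 0 := by simp [h]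
    have := integral_exp_mul_complex (a := 0) (b := 2 * Real.pi) hc
    rw [show (fun φ : ℝ => Complex.exp (n * φ * Complex.I)) =
      fun φ : ℝ => Complex.exp (n * Complex.I * φ) by ext φ; congr 1; ring, this]
    have h2 : Complex.exp (n * Complex.I * ((2 * Real.pi : ℝ) : ℂ)) = 1 := by
      rw [Complex.exp_eq_one_iff]
      exact ⟨n, by push_cast; ring⟩
    rw [h2]
    simp

/-- After binomial expansion, orthogonality of the characters leaves only the term of frequency
zero. -/
lemma integral_add_exp_pow (α β : ℂ) (k : ℕ) :
    ∫ φ in (0 : ℝ)..(2 * Real.pi),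
        (α * Complex.exp (φ * Complex.I) + β * Complex.exp (-(φ * Complex.I))) ^ k =
      ∑ i ∈ Finset.range (k + 1), α ^ i * β ^ (k - i) * (k.choose i : ℂ) *
        if 2 * i = k then 2 * (Real.pi : ℂ) else 0 := by
  have h : ∀ φ : ℝ, (α * Complex.exp (φ * Complex.I) + β * Complex.exp (-(φ * Complex.I))) ^ k =
      ∑ i ∈ Finset.range (k + 1), α ^ i * β ^ (k - i) * (k.choose i : ℂ) *
        Complex.exp (((2 * i - k : ℤ) : ℂ) * φ * Complex.I) := by
    intro φ
    rw [add_pow]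
    refine Finset.sum_congr rfl fun i hi => ?_
    have hi : i ≤ k := by simpa [Nat.lt_succ_iff] using hi
    rw [mul_pow, mul_pow, ← Complex.exp_nat_mul, ← Complex.exp_nat_mul]
    have : Complex.exp (((2 * i - k : ℤ) : ℂ) * φ * Complex.I) =
        Complex.exp ((i : ℂ) * (φ * Complex.I)) *
          Complex.exp (((k - i : ℕ) : ℂ) * -(φ * Complex.I)) := by
      rw [← Complex.exp_add]
      congr 1
      push_cast [hi]
      ring
    rw [this]
    ring
  simp only [h]
  rw [intervalIntegral.integral_finsetSum]
  · refine Finset.sum_congr rfl fun i _ => ?_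
    rw [intervalIntegral.integral_const_mul, integral_exp_int_mul_I]
    congr 1
    have : (2 * (i : ℤ) - k = 0) ↔ 2 * i = k := by omega
    simp only [this]
  · intro i _
    apply Continuous.intervalIntegrable
    fun_prop

lemma integral_add_exp_pow_odd (α β : ℂ) {k : ℕ} (hk : Odd k) :
    ∫ φ in (0 : ℝ)..(2 * Real.pi),
        (α * Complex.exp (φ * Complex.I) + β * Complex.exp (-(φ * Complex.I))) ^ k = 0 := by
  rw [integral_add_exp_pow]
  refine Finset.sum_eq_zero fun i _ => ?_
  obtain ⟨j, rfl⟩ := hk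
  rw [if_neg (by omega), mul_zero]

lemma integral_add_exp_pow_even (α β : ℂ) (j : ℕ) :
    ∫ φ in (0 : ℝ)..(2 * Real.pi),
        (α * Complex.exp (φ * Complex.I) + β * Complex.exp (-(φ * Complex.I))) ^ (2 * j) =
      (α * β) ^ j * ((2 * j).choose j : ℂ) * (2 * Real.pi) := by
  rw [integral_add_exp_pow, Finset.sum_eq_single j]
  · rw [if_pos rfl, mul_pow, show 2 * j - j = j by omega]
  · intro i _ hi
    rw [if_neg (by omega), mul_zero]
  · intro h
    exact absurd (Finset.mem_range.2 (by omega)) h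

/-- The polar moments `∫ cos^a sin^(2j+1)`. -/
noncomputable def polarMoment (a j : ℕ) : ℝ :=
  ∫ θ in (0 : ℝ)..Real.pi, Real.cos θ ^ a * Real.sin θ ^ (2 * j + 1)

lemma polarMoment_zero_right (a : ℕ) : polarMoment a 0 = (1 + (-1) ^ a) / (a + 1) := by
  unfold polarMoment
  have h : ∀ θ ∈ Set.uIcc 0 Real.pi, HasDerivAt (fun θ => -(Real.cos θ ^ (a + 1) / ((a : ℝ) + 1)))
      (Real.cos θ ^ a * Real.sin θ ^ (2 * 0 + 1)) θ := by
    intro θ _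
    refine (((Real.hasDerivAt_cos θ).fun_pow (a + 1)).div_const ((a : ℝ) + 1)).fun_neg.congr_deriv ?_
    push_cast
    field_simp
  rw [intervalIntegral.integral_eq_sub_of_hasDerivAt h
    (Continuous.intervalIntegrable (by fun_prop) _ _)]
  simp only [Real.cos_pi, Real.cos_zero, pow_succ]
  ring

/-- Integration by parts: the derivative of `cos^(a+1) sin^(2j+2)` integrates to zero because the
sine vanishes at both ends. -/
lemma polarMoment_succ_right (a j : ℕ) :
    ((a : ℝ) + 1) * polarMoment a (j + 1) = (2 * j + 2) * polarMoment (a + 2) j := by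
  unfold polarMoment
  have h : ∀ θ ∈ Set.uIcc 0 Real.pi,
      HasDerivAt (fun θ => Real.cos θ ^ (a + 1) * Real.sin θ ^ (2 * j + 2))
      ((2 * j + 2) * (Real.cos θ ^ (a + 2) * Real.sin θ ^ (2 * j + 1)) -
        (a + 1) * (Real.cos θ ^ a * Real.sin θ ^ (2 * (j + 1) + 1))) θ := by
    intro θ _
    refine (((Real.hasDerivAt_cos θ).fun_pow (a + 1)).fun_mul
      ((Real.hasDerivAt_sin θ).fun_pow (2 * j + 2))).congr_deriv ?_
    simp only [Nat.add_sub_cancel, show 2 * j + 2 - 1 = 2 * j + 1 by omega]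
    push_cast
    ring
  have := intervalIntegral.integral_eq_sub_of_hasDerivAt h
    (Continuous.intervalIntegrable (by fun_prop) _ _)
  rw [intervalIntegral.integral_sub (Continuous.intervalIntegrable (by fun_prop) _ _)
    (Continuous.intervalIntegrable (by fun_prop) _ _), intervalIntegral.integral_const_mul,
    intervalIntegral.integral_const_mul] at this
  simp at this
  linarith

lemma polarMoment_odd {a : ℕ} (ha : Odd a) (j : ℕ) : polarMoment a j = 0 := by
  induction j generalizing a with
  | zero => rw [polarMoment_zero_right, ha.neg_one_pow]; simp
  | succ j ih =>
    have h := polarMoment_succ_right a j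
    rw [ih (ha.add_even even_two), mul_zero] at h
    exact (mul_eq_zero.1 h).resolve_left (by positivity)

lemma polarMoment_even (b j : ℕ) :
    polarMoment (2 * b) j = 4 ^ j * (Nat.factorial (2 * b) * Nat.factorial j * Nat.factorial (b + j) /
      (Nat.factorial (2 * b + 2 * j) * Nat.factorial b)) * (2 / (2 * b + 2 * j + 1)) := by
  induction j generalizing b with
  | zero =>
    rw [polarMoment_zero_right, (even_two_mul b).neg_one_pow]
    have h1 := Nat.factorial_pos (2 * b)
    have h2 := Nat.factorial_pos b
    push_cast
    simp only [mul_zero, add_zero, Nat.factorial_zero]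
    field_simp
    norm_num
  | succ j ih =>
    have h := polarMoment_succ_right (2 * b) j
    have ih' := ih (b + 1)
    rw [show 2 * (b + 1) = 2 * b + 2 by ring] at ih'
    rw [ih', show 2 * b + 2 + 2 * j = 2 * b + 2 * (j + 1) by ring,
      show b + 1 + j = b + (j + 1) by ring] at h
    have h0 : ((2 * b : ℕ) : ℝ) + 1 ≠ 0 := by positivity
    apply mul_left_cancel₀ h0
    rw [h]
    simp only [Nat.factorial_succ, pow_succ]
    push_cast
    field_simp
    ring

lemma sum_range_of_odd_eq_zero {f : ℕ → ℂ} (hf : ∀ k, Odd k → f k = 0) (n : ℕ) :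
    ∑ k ∈ Finset.range (2 * n + 1), f k = ∑ j ∈ Finset.range (n + 1), f (2 * j) := by
  induction n with
  | zero => simp
  | succ n ih =>
    rw [show 2 * (n + 1) + 1 = 2 * n + 1 + 1 + 1 by ring, Finset.sum_range_succ,
      Finset.sum_range_succ, ih, hf (2 * n + 1) ⟨n, rfl⟩, Finset.sum_range_succ _ (n + 1)]
    simp [mul_add]

lemma dirForm_eq_exp (z : Fin 3 → ℂ) (φ θ : ℝ) :
    dirForm z φ θ = Real.sin θ * ((z 0 - Complex.I * z 1) / 2 * Complex.exp (φ * Complex.I) +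
      (z 0 + Complex.I * z 1) / 2 * Complex.exp (-(φ * Complex.I))) + z 2 * Real.cos θ := by
  have h : Complex.exp (-(φ * Complex.I)) = Complex.cos φ - Complex.sin φ * Complex.I := by
    rw [← neg_mul, Complex.exp_mul_I, Complex.cos_neg, Complex.sin_neg]
    ring
  rw [dirForm, h, Complex.exp_mul_I, Complex.ofReal_cos φ, Complex.ofReal_sin φ]
  linear_combination (z 1 * Real.sin θ * Complex.sin φ) * Complex.I_sq

/-- Writing the form as `sin θ (α e^{iφ} + β e^{-iφ}) + z₂ cos θ` separates the two angles in each
binomial term. -/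
lemma sphereIntegral_dirForm_pow_eq_sum (z : Fin 3 → ℂ) (N : ℕ) :
    sphereIntegral (fun φ θ => dirForm z φ θ ^ N) =
      ∑ k ∈ Finset.range (N + 1),
        (∫ φ in (0 : ℝ)..(2 * Real.pi),
          ((z 0 - Complex.I * z 1) / 2 * Complex.exp (φ * Complex.I) +
            (z 0 + Complex.I * z 1) / 2 * Complex.exp (-(φ * Complex.I))) ^ k) *
        ((N.choose k : ℂ) * z 2 ^ (N - k) *
          ((∫ θ in (0 : ℝ)..Real.pi, Real.cos θ ^ (N - k) * Real.sin θ ^ (k + 1) : ℝ) : ℂ)) := by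
  set α := (z 0 - Complex.I * z 1) / 2
  set β := (z 0 + Complex.I * z 1) / 2
  have h : ∀ φ θ : ℝ, dirForm z φ θ ^ N * (Real.sin θ : ℂ) = ∑ k ∈ Finset.range (N + 1),
      (α * Complex.exp (φ * Complex.I) + β * Complex.exp (-(φ * Complex.I))) ^ k *
        ((N.choose k : ℂ) * z 2 ^ (N - k)) *
          ((Real.cos θ ^ (N - k) * Real.sin θ ^ (k + 1) : ℝ) : ℂ) := by
    intro φ θ
    rw [dirForm_eq_exp, add_pow, Finset.sum_mul]
    refine Finset.sum_congr rfl fun k _ => ?_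
    push_cast
    rw [mul_pow, mul_pow]
    ring
  unfold sphereIntegral
  simp only [h]
  have h2 : ∀ φ : ℝ, ∫ θ in (0 : ℝ)..Real.pi, ∑ k ∈ Finset.range (N + 1),
      (α * Complex.exp (φ * Complex.I) + β * Complex.exp (-(φ * Complex.I))) ^ k *
        ((N.choose k : ℂ) * z 2 ^ (N - k)) *
          ((Real.cos θ ^ (N - k) * Real.sin θ ^ (k + 1) : ℝ) : ℂ) =
      ∑ k ∈ Finset.range (N + 1),
      (α * Complex.exp (φ * Complex.I) + β * Complex.exp (-(φ * Complex.I))) ^ k *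
        ((N.choose k : ℂ) * z 2 ^ (N - k) *
          ((∫ θ in (0 : ℝ)..Real.pi, Real.cos θ ^ (N - k) * Real.sin θ ^ (k + 1) : ℝ) : ℂ)) := by
    intro φ
    rw [intervalIntegral.integral_finsetSum]
    · refine Finset.sum_congr rfl fun k _ => ?_
      rw [intervalIntegral.integral_const_mul, intervalIntegral.integral_ofReal, mul_assoc]
    · intro k _
      apply Continuous.intervalIntegrable
      fun_prop
  simp only [h2]
  rw [intervalIntegral.integral_finsetSum]
  · simp only [intervalIntegral.integral_mul_const]
  · intro k _
    apply Continuous.intervalIntegrable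
    fun_prop

lemma sphereIntegral_dirForm_pow_odd (z : Fin 3 → ℂ) {N : ℕ} (hN : Odd N) :
    sphereIntegral (fun φ θ => dirForm z φ θ ^ N) = 0 := by
  rw [sphereIntegral_dirForm_pow_eq_sum]
  refine Finset.sum_eq_zero fun k hk => ?_
  have hk : k ≤ N := by simpa [Nat.lt_succ_iff] using hk
  rcases Nat.even_or_odd' k with ⟨j, rfl | rfl⟩
  · have := polarMoment_odd (a := N - 2 * j)
      (Nat.Odd.sub_even hk hN (even_two_mul j)) j
    unfold polarMoment at this
    rw [this]
    simp
  · rw [integral_add_exp_pow_odd _ _ ⟨j, rfl⟩, zero_mul]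

/-- For real `z` this is rotation invariance; for complex `z` the summands are matched one by one
with the binomial expansion of `(4αβ + z₂²)^n`, as `z₀² + z₁² = 4αβ`. -/
lemma sphereIntegral_dirForm_pow_even (z : Fin 3 → ℂ) (n : ℕ) :
    sphereIntegral (fun φ θ => dirForm z φ θ ^ (2 * n)) =
      4 * Real.pi / (2 * n + 1) * (z 0 ^ 2 + z 1 ^ 2 + z 2 ^ 2) ^ n := by
  rw [sphereIntegral_dirForm_pow_eq_sum, sum_range_of_odd_eq_zero]
  · have h : (z 0 ^ 2 + z 1 ^ 2 + z 2 ^ 2 : ℂ) = 4 * ((z 0 - Complex.I * z 1) / 2 *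
        ((z 0 + Complex.I * z 1) / 2)) + z 2 ^ 2 := by
      linear_combination (z 1 ^ 2) * Complex.I_sq
    rw [h, add_pow, Finset.mul_sum]
    refine Finset.sum_congr rfl fun j hj => ?_
    obtain ⟨b, rfl⟩ : ∃ b, n = b + j :=
      Nat.exists_eq_add_of_le' (by simpa [Nat.lt_succ_iff] using hj)
    have hm := polarMoment_even b j
    unfold polarMoment at hm
    rw [integral_add_exp_pow_even, show 2 * (b + j) - 2 * j = 2 * b by omega, hm,
      Nat.add_sub_cancel, ← pow_mul]
    have h1 : ((2 * (b + j)).choose (2 * j) : ℂ) =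
        (2 * b + 2 * j).factorial / ((2 * j).factorial * (2 * b).factorial) := by
      rw [← mul_add, Nat.cast_choose ℂ (by omega), show 2 * (b + j) - 2 * j = 2 * b by omega]
    have h2 : ((2 * j).choose j : ℂ) = (2 * j).factorial / (j.factorial * j.factorial) := by
      rw [Nat.cast_choose ℂ (by omega), show 2 * j - j = j by omega]
    have h3 : ((b + j).choose j : ℂ) = (b + j).factorial / (j.factorial * b.factorial) := by
      rw [Nat.cast_choose ℂ (by omega), Nat.add_sub_cancel]
    rw [h1, h2, h3]
    have f : ∀ n : ℕ, ((n.factorial : ℕ) : ℂ) ≠ 0 := fun n => by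
      exact_mod_cast n.factorial_ne_zero
    have g : (2 * (b : ℂ) + 2 * j + 1) ≠ 0 := by exact_mod_cast Nat.succ_ne_zero (2 * b + 2 * j)
    have g' : (2 * ((b : ℂ) + j) + 1) ≠ 0 := by rwa [mul_add]
    have f1 := f (2 * b + 2 * j)
    have f2 := f (2 * b)
    have f3 := f (2 * j)
    have f4 := f b
    have f5 := f j
    push_cast
    rw [mul_pow 4]
    field_simp
    ring
  · intro k hk
    rw [integral_add_exp_pow_odd _ _ hk, zero_mul]

/-! ### Polarization: mixed moments with an isotropic vector. -/

lemma coeff_eq_of_sum_eq {N : ℕ} {a b : ℕ → ℂ}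
    (h : ∀ t : ℂ, ∑ j ∈ Finset.range N, a j * t ^ j = ∑ j ∈ Finset.range N, b j * t ^ j)
    {j : ℕ} (hj : j < N) : a j = b j := by
  have h2 : ∑ j ∈ Finset.range N, Polynomial.monomial j (a j) =
      ∑ j ∈ Finset.range N, Polynomial.monomial j (b j) := by
    apply Polynomial.funext
    intro t
    simpa [Polynomial.eval_finsetSum, Polynomial.eval_monomial] using h t
  have h3 := congrArg (fun p => Polynomial.coeff p j) h2
  simpa [Polynomial.finsetSum_coeff, Polynomial.coeff_monomial, hj] using h3

/-- The complex bilinear dot product on `ℂ³`. -/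
def dotForm (z w : Fin 3 → ℂ) : ℂ := z 0 * w 0 + z 1 * w 1 + z 2 * w 2

lemma sum_choose_mul_sphereIntegral (z w : Fin 3 → ℂ) (N : ℕ) (t : ℂ) :
    ∑ l ∈ Finset.range (N + 1), ((N.choose l : ℂ) *
        sphereIntegral (fun φ θ => dirForm w φ θ ^ l * dirForm z φ θ ^ (N - l))) * t ^ l =
      sphereIntegral (fun φ θ => dirForm (fun i => t * w i + z i) φ θ ^ N) := by
  have h : ∀ φ θ : ℝ, dirForm (fun i => t * w i + z i) φ θ ^ N =
      ∑ l ∈ Finset.range (N + 1), ((N.choose l : ℂ) * t ^ l) *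
        (dirForm w φ θ ^ l * dirForm z φ θ ^ (N - l)) := by
    intro φ θ
    have : dirForm (fun i => t * w i + z i) φ θ = t * dirForm w φ θ + dirForm z φ θ := by
      simp only [dirForm]
      ring
    rw [this, add_pow]
    refine Finset.sum_congr rfl fun l _ => ?_
    rw [mul_pow]
    ring
  simp only [h]
  rw [sphereIntegral_finsetSum]
  · refine Finset.sum_congr rfl fun l _ => ?_
    rw [sphereIntegral_const_mul]
    ring
  · intro l _
    simp only [Function.uncurry_def]
    fun_prop

lemma sphereIntegral_mixed_odd (z w : Fin 3 → ℂ) {l n : ℕ} (h : Odd (l + n)) :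
    sphereIntegral (fun φ θ => dirForm w φ θ ^ l * dirForm z φ θ ^ n) = 0 := by
  have h1 := coeff_eq_of_sum_eq (N := l + n + 1)
    (a := fun k => ((l + n).choose k : ℂ) *
      sphereIntegral (fun φ θ => dirForm w φ θ ^ k * dirForm z φ θ ^ (l + n - k)))
    (b := fun _ => 0) (fun t => by
      rw [sum_choose_mul_sphereIntegral, sphereIntegral_dirForm_pow_odd _ h]
      simp) (j := l) (by omega)
  simp only [Nat.add_sub_cancel_left] at h1
  refine (mul_eq_zero.1 h1).resolve_left ?_
  exact_mod_cast (Nat.choose_pos (by omega)).ne'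

/-- Isotropy of `w` makes the square of `z + t w` linear in `t`, namely `2t z·w + z·z`. Its `q`-th
power is compared coefficientwise with the polarized moment of degree `2q`. -/
lemma choose_mul_sphereIntegral_mixed_even (z w : Fin 3 → ℂ) (hw : dotForm w w = 0) {l n q : ℕ}
    (h : l + n = 2 * q) :
    ((2 * q).choose l : ℂ) *
        sphereIntegral (fun φ θ => dirForm w φ θ ^ l * dirForm z φ θ ^ n) =
      4 * Real.pi / (2 * q + 1) *
        ((q.choose l : ℂ) * (2 * dotForm z w) ^ l * dotForm z z ^ (q - l)) := by
  have h1 := coeff_eq_of_sum_eq (N := 2 * q + 1)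
    (a := fun k => ((2 * q).choose k : ℂ) *
      sphereIntegral (fun φ θ => dirForm w φ θ ^ k * dirForm z φ θ ^ (2 * q - k)))
    (b := fun k => 4 * Real.pi / (2 * q + 1) *
        ((q.choose k : ℂ) * (2 * dotForm z w) ^ k * dotForm z z ^ (q - k))) (fun t => by
      rw [sum_choose_mul_sphereIntegral, sphereIntegral_dirForm_pow_even]
      have : (t * w 0 + z 0) ^ 2 + (t * w 1 + z 1) ^ 2 + (t * w 2 + z 2) ^ 2 =
          2 * dotForm z w * t + dotForm z z := by
        unfold dotForm at *
        linear_combination t ^ 2 * hw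
      rw [this, add_pow, Finset.mul_sum]
      rw [← Finset.sum_subset (Finset.range_mono (show q + 1 ≤ 2 * q + 1 by omega))]
      · refine Finset.sum_congr rfl fun k _ => ?_
        rw [mul_pow]
        ring
      · intro k _ hk
        rw [Nat.choose_eq_zero_of_lt (by simpa using hk)]
        simp) (j := l) (by omega)
  simpa only [show 2 * q - l = n by omega] using h1

/-- Orthogonality of degree `l` harmonics to lower degrees: the polarized side has degree `q < l` in
`t`. -/
lemma sphereIntegral_mixed_lt (z w : Fin 3 → ℂ) (hw : dotForm w w = 0) {l n : ℕ} (h : n < l) :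
    sphereIntegral (fun φ θ => dirForm w φ θ ^ l * dirForm z φ θ ^ n) = 0 := by
  rcases Nat.even_or_odd' (l + n) with ⟨q, hq | hq⟩
  · have h1 := choose_mul_sphereIntegral_mixed_even z w hw hq
    rw [Nat.choose_eq_zero_of_lt (show q < l by omega)] at h1
    simp only [Nat.cast_zero, zero_mul, mul_zero] at h1
    refine (mul_eq_zero.1 h1).resolve_left ?_
    exact_mod_cast (Nat.choose_pos (by omega)).ne'
  · exact sphereIntegral_mixed_odd z w ⟨q, hq⟩

lemma sphereIntegral_mixed_add (z w : Fin 3 → ℂ) (hw : dotForm w w = 0) (l p : ℕ) :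
    sphereIntegral (fun φ θ => dirForm w φ θ ^ l * dirForm z φ θ ^ (l + 2 * p)) =
      4 * Real.pi * ((l + 2 * p).factorial * 2 ^ l * (l + p).factorial /
        (p.factorial * (2 * l + 2 * p + 1).factorial)) * dotForm z w ^ l * dotForm z z ^ p := by
  have h1 := choose_mul_sphereIntegral_mixed_even z w hw (l := l) (n := l + 2 * p) (q := l + p)
    (by ring)
  have f : ∀ n : ℕ, ((n.factorial : ℕ) : ℂ) ≠ 0 := fun n => by
    exact_mod_cast n.factorial_ne_zero
  rw [Nat.cast_choose ℂ (by omega), Nat.cast_choose ℂ (by omega),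
    show 2 * (l + p) - l = l + 2 * p by omega, Nat.add_sub_cancel_left,
    show 2 * (l + p) = 2 * l + 2 * p by ring] at h1
  have g : (2 * (l : ℂ) + 2 * p + 1) ≠ 0 := by exact_mod_cast Nat.succ_ne_zero (2 * l + 2 * p)
  have g' : (2 * ((l : ℂ) + p) + 1) ≠ 0 := by rwa [mul_add]
  have h0 : ((2 * l + 2 * p).factorial / (l.factorial * (l + 2 * p).factorial) : ℂ) ≠ 0 :=
    div_ne_zero (f _) (mul_ne_zero (f _) (f _))
  apply mul_left_cancel₀ h0
  rw [h1, Nat.factorial_succ]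
  have f1 := f (2 * l + 2 * p)
  have f2 := f (l + 2 * p)
  have f3 := f p
  have f4 := f l
  have f5 := f (l + p)
  push_cast
  rw [mul_pow]
  field_simp

/-! ### Plane waves against powers of an isotropic form. -/

lemma norm_dirForm_le (z : Fin 3 → ℂ) (φ θ : ℝ) :
    ‖dirForm z φ θ‖ ≤ ‖z 0‖ + ‖z 1‖ + ‖z 2‖ := by
  have key : ∀ (c : ℂ) (a b : ℝ), |a| ≤ 1 → |b| ≤ 1 → ‖c * (a * b)‖ ≤ ‖c‖ := by
    intro c a b ha hb
    rw [norm_mul, norm_mul, Complex.norm_real, Complex.norm_real]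
    exact mul_le_of_le_one_right (norm_nonneg _) (mul_le_one₀ ha (abs_nonneg _) hb)
  refine (norm_add₃_le).trans (add_le_add (add_le_add ?_ ?_) ?_)
  · exact key _ _ _ (Real.abs_sin_le_one _) (Real.abs_cos_le_one _)
  · exact key _ _ _ (Real.abs_sin_le_one _) (Real.abs_sin_le_one _)
  · simpa using key (z 2) (Real.cos θ) 1 (Real.abs_cos_le_one _) (by simp)

/-- The Taylor remainder of the exponential is uniform in the angles because the form is bounded by
`B`, so sum and integral may be exchanged. -/
lemma hasSum_sphereIntegral_exp {g : ℝ → ℝ → ℂ} (hg : Continuous (Function.uncurry g)) {C : ℝ}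
    (hC : ∀ φ θ, ‖g φ θ‖ ≤ C) (z : Fin 3 → ℂ) :
    HasSum (fun n : ℕ => Complex.I ^ n / n.factorial *
        sphereIntegral (fun φ θ => g φ θ * dirForm z φ θ ^ n))
      (sphereIntegral fun φ θ => g φ θ * Complex.exp (Complex.I * dirForm z φ θ)) := by
  set B := ‖z 0‖ + ‖z 1‖ + ‖z 2‖
  have hC0 : 0 ≤ C := (norm_nonneg _).trans (hC 0 0)
  have hB0 : 0 ≤ B := by positivity
  have hg' : Continuous fun p : ℝ × ℝ => g p.1 p.2 := hg
  have hsum : Summable (fun n : ℕ => Complex.I ^ n / n.factorial *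
        sphereIntegral (fun φ θ => g φ θ * dirForm z φ θ ^ n)) := by
    refine Summable.of_norm_bounded
      (g := fun n : ℕ => (C * (2 * Real.pi ^ 2)) * (B ^ n / n.factorial))
      ((Real.summable_pow_div_factorial B).mul_left _) fun n => ?_
    have h1 : ‖sphereIntegral (fun φ θ => g φ θ * dirForm z φ θ ^ n)‖ ≤
        C * B ^ n * (2 * Real.pi ^ 2) := by
      refine norm_sphereIntegral_le fun φ _ θ _ => ?_
      rw [norm_mul, norm_pow]
      have := norm_dirForm_le z φ θ
      have := hC φ θ
      gcongr
    rw [norm_mul, norm_div, norm_pow, Complex.norm_I, one_pow, Complex.norm_natCast]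
    calc _ ≤ 1 / (n.factorial : ℝ) * (C * B ^ n * (2 * Real.pi ^ 2)) := by gcongr
      _ = _ := by ring
  refine (hsum.hasSum_iff_tendsto_nat).2 ?_
  rw [tendsto_iff_norm_sub_tendsto_zero]
  have hlim : Tendsto (fun n : ℕ => (C * 2 * (2 * Real.pi ^ 2)) * (B ^ n / n.factorial))
      atTop (𝓝 0) := by
    simpa using (FloorSemiring.tendsto_pow_div_factorial_atTop B).const_mul
      (C * 2 * (2 * Real.pi ^ 2))
  refine squeeze_zero' (Eventually.of_forall fun _ => norm_nonneg _) ?_ hlim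
  -- `Complex.exp_bound'` needs the argument to be at most half of `n + 1`.
  filter_upwards [eventually_ge_atTop ⌈2 * B⌉₊] with n hn
  have hn : 2 * B ≤ n := Nat.ceil_le.1 hn
  have h1 : ∑ i ∈ Finset.range n, Complex.I ^ i / i.factorial *
      sphereIntegral (fun φ θ => g φ θ * dirForm z φ θ ^ i) =
      sphereIntegral (fun φ θ => ∑ i ∈ Finset.range n, Complex.I ^ i / i.factorial *
        (g φ θ * dirForm z φ θ ^ i)) := by
    rw [sphereIntegral_finsetSum]
    · simp only [sphereIntegral_const_mul]
    · intro i _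
      simp only [Function.uncurry_def]
      fun_prop
  rw [h1, norm_sub_rev, ← sphereIntegral_sub]
  · refine (norm_sphereIntegral_le (C := C * (B ^ n / n.factorial * 2)) ?_).trans_eq
      (by ring)
    intro φ _ θ _
    have h2 : g φ θ * Complex.exp (Complex.I * dirForm z φ θ) -
        ∑ i ∈ Finset.range n, Complex.I ^ i / i.factorial * (g φ θ * dirForm z φ θ ^ i) =
        g φ θ * (Complex.exp (Complex.I * dirForm z φ θ) -
          ∑ i ∈ Finset.range n, (Complex.I * dirForm z φ θ) ^ i / i.factorial) := by
      rw [mul_sub, Finset.mul_sum]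
      congr 1
      refine Finset.sum_congr rfl fun i _ => ?_
      rw [mul_pow]
      ring
    rw [h2, norm_mul]
    have h3 := norm_dirForm_le z φ θ
    have h4 : ‖Complex.I * dirForm z φ θ‖ ≤ B := by rwa [norm_mul, Complex.norm_I, one_mul]
    have h5 := Complex.exp_bound' (x := Complex.I * dirForm z φ θ) (n := n) (by
      rw [div_le_iff₀ (by positivity)]
      push_cast
      linarith)
    refine mul_le_mul (hC φ θ) (h5.trans ?_) (norm_nonneg _) hC0
    gcongr
  · simp only [Function.uncurry_def]
    fun_prop
  · simp only [Function.uncurry_def]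
    fun_prop

/-- The factor `j_ℓ(a)` (the spherical Bessel function) of the plane wave expansion. -/
noncomputable def sphBessel (l : ℕ) (a : ℝ) : ℝ :=
  ∑' p : ℕ, (-1) ^ p * (2 ^ l * (l + p).factorial / (p.factorial * (2 * l + 2 * p + 1).factorial)) *
    a ^ (l + 2 * p)

lemma hasSum_sphBessel (l : ℕ) (a : ℝ) :
    HasSum (fun p : ℕ => (-1) ^ p *
      (2 ^ l * (l + p).factorial / (p.factorial * (2 * l + 2 * p + 1).factorial)) *
        a ^ (l + 2 * p)) (sphBessel l a) := by
  refine Summable.hasSum (Summable.of_norm_bounded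
    (g := fun p : ℕ => (2 ^ l * |a| ^ l) * ((a ^ 2) ^ p / p.factorial))
    ((Real.summable_pow_div_factorial (a ^ 2)).mul_left _) fun p => ?_)
  rw [norm_mul, norm_mul, norm_pow, norm_neg, norm_one, one_pow, one_mul, Real.norm_eq_abs,
    Real.norm_eq_abs, abs_of_nonneg (by positivity), abs_pow, pow_add, pow_mul, sq_abs]
  have h : ((l + p).factorial : ℝ) ≤ (2 * l + 2 * p + 1).factorial := by
    exact_mod_cast Nat.factorial_le (by omega)
  have h1 : (0 : ℝ) < p.factorial := by exact_mod_cast p.factorial_pos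
  have h2 : (0 : ℝ) < (2 * l + 2 * p + 1).factorial := by exact_mod_cast Nat.factorial_pos _
  calc _ ≤ (2 ^ l * (2 * l + 2 * p + 1).factorial / (p.factorial * (2 * l + 2 * p + 1).factorial)) *
        (|a| ^ l * (a ^ 2) ^ p) := by gcongr
    _ = _ := by field_simp

/-- Only the exponents `n = l + 2p` contribute to the exponential series; there `I^n = I^l (-1)^p`,
and the factor `n!` of the moment cancels the Taylor denominator. -/
lemma sphereIntegral_isotropic_mul_exp (w : Fin 3 → ℂ) (hw : dotForm w w = 0) (v : Fin 3 → ℂ)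
    (hv : dotForm v v = 1) (a : ℝ) (l : ℕ) :
    sphereIntegral (fun φ θ => dirForm w φ θ ^ l *
        Complex.exp (Complex.I * dirForm (fun i => a * v i) φ θ)) =
      4 * Real.pi * Complex.I ^ l * sphBessel l a * dotForm v w ^ l := by
  have h1 := hasSum_sphereIntegral_exp (g := fun φ θ => dirForm w φ θ ^ l)
    (by simp only [Function.uncurry_def]; fun_prop)
    (fun φ θ => by
      rw [norm_pow]
      exact pow_le_pow_left₀ (norm_nonneg _) (norm_dirForm_le w φ θ) l) (fun i => a * v i)
  have hinj : Function.Injective fun p : ℕ => l + 2 * p := fun p q h => by simpa using h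
  rw [← hinj.hasSum_iff] at h1
  · refine h1.unique ?_
    have h2 := ((Complex.hasSum_ofReal.2 (hasSum_sphBessel l a)).mul_left
      (4 * Real.pi * Complex.I ^ l)).mul_right (dotForm v w ^ l)
    refine Eq.mpr (congrArg (fun f => HasSum f _) (funext fun p => ?_)) h2
    have e1 : dotForm (fun i => a * v i) w = a * dotForm v w := by
      unfold dotForm
      ring
    have e2 : dotForm (fun i => a * v i) (fun i => a * v i) = a ^ 2 := by
      unfold dotForm at hv ⊢
      linear_combination (a : ℂ) ^ 2 * hv
    have f1 : ((l + 2 * p).factorial : ℂ) ≠ 0 := by exact_mod_cast Nat.factorial_ne_zero _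
    simp only [Function.comp_apply]
    rw [sphereIntegral_mixed_add _ _ hw, e1, e2, pow_add Complex.I, pow_mul Complex.I,
      Complex.I_sq]
    push_cast
    field_simp
    ring
  · intro n hn
    rcases lt_or_ge n l with h | h
    · rw [sphereIntegral_mixed_lt _ _ hw h, mul_zero]
    · rw [sphereIntegral_mixed_odd, mul_zero]
      by_contra hodd
      obtain ⟨q, hq⟩ := Nat.not_odd_iff_even.1 hodd
      exact hn ⟨q - l, by simp only; omega⟩

/-! ### Generating polynomial of the spherical harmonics and the plane wave expansion. -/

section SphericalHarmonics

open Polynomial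

/-- Taylor expansion of `(X² - 1)^l` at `c` turns the derivative into a coefficient of `(X² + 2cX -
S²)^l`. Rescaling `X` by `S` then absorbs the weight `S^(j-l)`. -/
lemma coeff_shifted_pow {S c : ℝ} (hS : 0 ≤ S) (h : S ^ 2 + c ^ 2 = 1) (l j : ℕ) :
    (1 - c ^ 2) ^ ((((j : ℤ) - l : ℤ) : ℝ) / 2) *
        (derivative^[j] ((X ^ 2 - 1 : ℝ[X]) ^ l)).eval c =
      j.factorial * ((C S * X ^ 2 + C (2 * c) * X - C S) ^ l).coeff j := by
  have hder : (derivative^[j] ((X ^ 2 - 1 : ℝ[X]) ^ l)).eval c =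
      j.factorial * ((X ^ 2 + C (2 * c) * X - C (S ^ 2)) ^ l).coeff j := by
    have h1 : ((X ^ 2 + C (2 * c) * X - C (S ^ 2)) ^ l : ℝ[X]) =
        taylor c ((X ^ 2 - 1 : ℝ[X]) ^ l) := by
      rw [taylor_apply]
      simp only [pow_comp, sub_comp, X_comp, one_comp]
      congr 1
      have : S ^ 2 = 1 - c ^ 2 := by linarith
      rw [this]
      simp only [map_sub, map_mul, map_pow, map_one, map_ofNat]
      ring
    rw [h1, taylor_coeff, ← factorial_smul_hasseDeriv]
    simp
  rw [hder, show 1 - c ^ 2 = S ^ 2 by linarith]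
  -- At the poles the rescaling degenerates. There both sides vanish unless `j = l`, since `0 ^ x =
  -- 0` for every real `x ≠ 0`, negative exponents included.
  rcases hS.eq_or_lt with h0 | h0
  · subst h0
    have h4 : (C (0 : ℝ) * X ^ 2 + C (2 * c) * X - C 0) ^ l = C ((2 * c) ^ l) * X ^ l := by
      simp [mul_pow]
    rcases eq_or_ne j l with rfl | hj
    · have h2 : (X ^ 2 + C (2 * c) * X - C ((0 : ℝ) ^ 2)) ^ j = (X + C (2 * c)) ^ j * X ^ j := by
        rw [← mul_pow]
        congr 1
        simp
        ring
      have h3 : ((X + C (2 * c)) ^ j * X ^ j : ℝ[X]).coeff j = (2 * c) ^ j := by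
        have := coeff_mul_X_pow ((X + C (2 * c)) ^ j : ℝ[X]) j 0
        rw [zero_add] at this
        rw [this, coeff_zero_eq_eval_zero]
        simp
      rw [h2, h3, h4, coeff_C_mul, coeff_X_pow, if_pos rfl]
      simp
    · have h3 : ((((j : ℤ) - l : ℤ) : ℝ) / 2) ≠ 0 := by
        have : ((j : ℤ) - l : ℤ) ≠ 0 := by omega
        exact div_ne_zero (by exact_mod_cast this) two_ne_zero
      rw [h4, coeff_C_mul, coeff_X_pow, if_neg hj, zero_pow two_ne_zero, Real.zero_rpow h3]
      simp
  · have h2 : ((X ^ 2 + C (2 * c) * X - C (S ^ 2)) ^ l).comp (C S * X) =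
        C (S ^ l) * (C S * X ^ 2 + C (2 * c) * X - C S) ^ l := by
      simp only [pow_comp, sub_comp, add_comp, mul_comp, X_comp, C_comp]
      rw [show C (S ^ l) = (C S : ℝ[X]) ^ l from C_pow, ← mul_pow]
      congr 1
      simp only [map_mul, map_pow, map_ofNat]
      ring
    have h3 := congrArg (fun p => coeff p j) h2
    simp only [comp_C_mul_X_coeff, coeff_C_mul] at h3
    have h4 : (S ^ 2) ^ ((((j : ℤ) - l : ℤ) : ℝ) / 2) = S ^ j / S ^ l := by
      rw [← Real.rpow_natCast S 2, ← Real.rpow_mul hS]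
      have : ((2 : ℕ) : ℝ) * ((((j : ℤ) - l : ℤ) : ℝ) / 2) = (j : ℝ) - l := by
        push_cast
        ring
      rw [this, Real.rpow_sub h0, Real.rpow_natCast, Real.rpow_natCast]
    rw [h4]
    field_simp
    linear_combination h3

/-- The generating polynomial of the spherical harmonics of degree `l`: its coefficients are
multiples of `Y_l^m`. -/
noncomputable def harmonicPoly (l : ℕ) (φ θ : ℝ) : ℂ[X] :=
  (C (Real.sin θ * Complex.exp (Complex.I * φ)) * X ^ 2 + C (2 * (Real.cos θ : ℂ)) * X -
    C (Real.sin θ * Complex.exp (-(Complex.I * φ)))) ^ l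

/-- Coefficients are continuous on all of `ℝ²`, which the defining formula with its possibly
negative powers of `1 - x²` does not show directly. -/
lemma continuous_coeff_harmonicPoly (l j : ℕ) :
    Continuous fun p : ℝ × ℝ => (harmonicPoly l p.1 p.2).coeff j := by
  unfold harmonicPoly
  induction l generalizing j with
  | zero => simp only [pow_zero]; exact continuous_const
  | succ l ih =>
    simp only [pow_succ, coeff_mul]
    refine continuous_finsetSum _ fun i _ => (ih i.1).mul ?_
    simp only [coeff_sub, coeff_add, coeff_C_mul, coeff_C]
    refine Continuous.sub (by fun_prop) ?_
    split_ifs <;> fun_prop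

/-- The null vector whose pairing with `dir φ θ` generates the spherical harmonics. -/
noncomputable def nullVector (t : ℂ) : Fin 3 → ℂ := ![t ^ 2 - 1, Complex.I * (t ^ 2 + 1), 2 * t]

lemma dotForm_nullVector (t : ℂ) : dotForm (nullVector t) (nullVector t) = 0 := by
  simp only [dotForm, nullVector, Matrix.cons_val]
  linear_combination (t ^ 2 + 1) ^ 2 * Complex.I_sq

lemma dirForm_nullVector_pow (l : ℕ) (t : ℂ) (φ θ : ℝ) :
    dirForm (nullVector t) φ θ ^ l =
      ∑ j ∈ Finset.range (2 * l + 1), (harmonicPoly l φ θ).coeff j * t ^ j := by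
  have hdeg : (harmonicPoly l φ θ).natDegree < 2 * l + 1 := by
    unfold harmonicPoly
    refine Nat.lt_succ_of_le (natDegree_pow_le.trans ?_)
    rw [mul_comm]
    refine Nat.mul_le_mul_right l ?_
    compute_degree
  rw [← eval_eq_sum_range' hdeg]
  simp only [harmonicPoly, eval_pow, eval_sub, eval_add, eval_mul, eval_C, eval_X]
  congr 1
  have h1 : Complex.exp (Complex.I * φ) = Complex.cos φ + Complex.sin φ * Complex.I := by
    rw [mul_comm, Complex.exp_mul_I]
  have h2 : Complex.exp (-(Complex.I * φ)) = Complex.cos φ - Complex.sin φ * Complex.I := by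
    rw [mul_comm, ← neg_mul, Complex.exp_mul_I, Complex.cos_neg, Complex.sin_neg]
    ring
  rw [h1, h2]
  simp only [dirForm, nullVector, Matrix.cons_val, Complex.ofReal_cos, Complex.ofReal_sin]
  ring

/-- Substituting `e^{iφ} X` in a real polynomial and extracting `e^{-ilφ}` isolates the azimuth; the
degree `j` then carries the frequency `m = j - l`. -/
lemma coeff_harmonicPoly (l j : ℕ) (φ θ : ℝ) :
    (harmonicPoly l φ θ).coeff j =
      (((C (Real.sin θ) * X ^ 2 + C (2 * Real.cos θ) * X - C (Real.sin θ)) ^ l : ℝ[X]).coeff j : ℂ) *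
        Complex.exp (Complex.I * ((j : ℤ) - l : ℤ) * φ) := by
  have h1 : harmonicPoly l φ θ = C (Complex.exp (-(Complex.I * φ)) ^ l) *
      (((C (Real.sin θ) * X ^ 2 + C (2 * Real.cos θ) * X - C (Real.sin θ)) ^ l : ℝ[X]).map
        Complex.ofRealHom).comp (C (Complex.exp (Complex.I * φ)) * X) := by
    unfold harmonicPoly
    simp only [Polynomial.map_pow, Polynomial.map_sub, Polynomial.map_add, Polynomial.map_mul,
      map_C, map_X, pow_comp, sub_comp, add_comp, mul_comp, X_comp, C_comp]
    rw [C_pow, ← mul_pow]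
    congr 1
    have h2 : (C (Complex.exp (-(Complex.I * φ))) * C (Complex.exp (Complex.I * φ)) : ℂ[X]) = 1 := by
      rw [← C_mul, ← Complex.exp_add, neg_add_cancel, Complex.exp_zero, C_1]
    simp only [map_mul, Complex.ofRealHom_eq_coe, map_ofNat]
    linear_combination (-(C (Real.sin θ : ℂ)) * C (Complex.exp (Complex.I * φ)) * X ^ 2 -
      2 * C (Real.cos θ : ℂ) * X) * h2
  rw [h1, coeff_C_mul, comp_C_mul_X_coeff, coeff_map, Complex.ofRealHom_eq_coe,
    ← Complex.exp_nat_mul, ← Complex.exp_nat_mul]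
  have h3 : Complex.exp (Complex.I * ((j : ℤ) - l : ℤ) * φ) =
      Complex.exp ((l : ℂ) * -(Complex.I * φ)) * Complex.exp ((j : ℂ) * (Complex.I * φ)) := by
    rw [← Complex.exp_add]
    congr 1
    push_cast
    ring
  rw [h3]
  ring

/-- The factor between the spherical harmonic `Y_l^m` and the coefficient of degree `l + m` of the
generating polynomial. -/
noncomputable def harmonicConst (l : ℕ) (m : ℤ) : ℝ :=
  Real.sqrt ((2 * (l : ℝ) + 1) / (4 * Real.pi) *
      ((Nat.factorial (l - m).toNat : ℝ) / (Nat.factorial (l + m).toNat : ℝ))) *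
    ((-1 : ℝ) ^ m / (2 ^ l * (Nat.factorial l : ℝ)) * (Nat.factorial (l + m).toNat : ℝ))

lemma sphericalHarmonic_eq_coeff {l : ℕ} {m : ℤ} (hm : -(l : ℤ) ≤ m) (φ : ℝ) {θ : ℝ}
    (hθ : θ ∈ Set.Icc 0 Real.pi) :
    sphericalHarmonic l m φ θ =
      harmonicConst l m * (harmonicPoly l φ θ).coeff (l + m).toNat := by
  obtain ⟨j, hj⟩ : ∃ j : ℕ, (l : ℤ) + m = j := ⟨(l + m).toNat, by omega⟩
  have hm' : m = j - l := by omega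
  have h1 := coeff_shifted_pow (Real.sin_nonneg_of_mem_Icc hθ) (Real.sin_sq_add_cos_sq θ) l j
  rw [coeff_harmonicPoly, sphericalHarmonic, assocLegendre, harmonicConst, add_comm m, hj,
    Int.toNat_natCast, ← hm']
  rw [← hm'] at h1
  rw [mul_assoc ((-1 : ℝ) ^ m / _), h1]
  push_cast
  ring

/-- **Plane wave expansion**: the integral of a plane wave against a spherical harmonic. -/
lemma sphereIntegral_sphericalHarmonic_mul_exp {l : ℕ} {m : ℤ} (hm : -(l : ℤ) ≤ m) (hm' : m ≤ l)
    (a φ₀ : ℝ) {θ₀ : ℝ} (hθ₀ : θ₀ ∈ Set.Icc 0 Real.pi) :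
    sphereIntegral (fun φ θ => Complex.exp (Complex.I *
        dirForm (fun i => a * (dir φ₀ θ₀ i : ℂ)) φ θ) * sphericalHarmonic l m φ θ) =
      4 * Real.pi * Complex.I ^ l * sphBessel l a * sphericalHarmonic l m φ₀ θ₀ := by
  set v : Fin 3 → ℂ := fun i => (dir φ₀ θ₀ i : ℂ) with hv
  have hvw : ∀ w, dotForm v w = dirForm w φ₀ θ₀ := by
    intro w
    simp [hv, dotForm, dirForm, dir]
    ring
  have hvv : dotForm v v = 1 := by
    rw [hvw]
    simp [hv, dirForm, dir]
    linear_combination Complex.sin θ₀ ^ 2 * Complex.sin_sq_add_cos_sq φ₀ +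
      Complex.sin_sq_add_cos_sq θ₀
  have h1 : sphereIntegral (fun φ θ => Complex.exp (Complex.I *
        dirForm (fun i => a * v i) φ θ) * sphericalHarmonic l m φ θ) =
      harmonicConst l m * sphereIntegral (fun φ θ => (harmonicPoly l φ θ).coeff (l + m).toNat *
        Complex.exp (Complex.I * dirForm (fun i => a * v i) φ θ)) := by
    rw [← sphereIntegral_const_mul]
    refine sphereIntegral_congr fun φ θ hθ => ?_
    rw [sphericalHarmonic_eq_coeff hm φ hθ]
    ring
  rw [h1, sphericalHarmonic_eq_coeff hm φ₀ hθ₀]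
  -- Both sides of the isotropic identity are polynomials in the parameter `t` of `nullVector`; the
  -- coefficient of `t^(l+m)` is the case of `Y_l^m`.
  have h2 := coeff_eq_of_sum_eq (N := 2 * l + 1)
    (a := fun j => sphereIntegral (fun φ θ => (harmonicPoly l φ θ).coeff j *
        Complex.exp (Complex.I * dirForm (fun i => a * v i) φ θ)))
    (b := fun j => 4 * Real.pi * Complex.I ^ l * sphBessel l a * (harmonicPoly l φ₀ θ₀).coeff j)
    (fun t => by
      have h3 := sphereIntegral_isotropic_mul_exp (nullVector t) (dotForm_nullVector t) v hvv a l
      rw [hvw, dirForm_nullVector_pow, Finset.mul_sum] at h3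
      simp only [dirForm_nullVector_pow, Finset.sum_mul] at h3
      rw [sphereIntegral_finsetSum] at h3
      · simp only [mul_assoc] at h3 ⊢
        rw [← h3]
        refine Finset.sum_congr rfl fun j _ => ?_
        rw [mul_comm, ← sphereIntegral_const_mul]
        congr 1
        ext φ θ
        ring
      · intro j _
        have := continuous_coeff_harmonicPoly l j
        simp only [Function.uncurry_def]
        fun_prop) (j := (l + m).toNat) (by omega)
  rw [h2]
  ring

end SphericalHarmonics

/-! ### Bessel functions of half-integer order. -/

lemma Gamma_nat_add_three_halves (n : ℕ) :
    Real.Gamma (n + 3 / 2) =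
      (2 * n + 1).factorial * Real.sqrt Real.pi / (2 ^ (2 * n + 1) * n.factorial) := by
  induction n with
  | zero =>
    rw [show ((0 : ℕ) : ℝ) + 3 / 2 = 1 / 2 + 1 by norm_num, Real.Gamma_add_one (by norm_num),
      Real.Gamma_one_half_eq]
    norm_num
    ring
  | succ n ih =>
    rw [show ((n + 1 : ℕ) : ℝ) + 3 / 2 = (n + 3 / 2) + 1 by push_cast; ring,
      Real.Gamma_add_one (by positivity), ih, show 2 * (n + 1) + 1 = 2 * n + 1 + 1 + 1 by ring]
    simp only [Nat.factorial_succ, pow_succ]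
    push_cast
    field_simp
    ring

/-- The series agree term by term: the half power of `a` cancels `√a`, and the `√π` in `Γ(l + k +
3/2)` cancels the one in `(2π)^(3/2)`. -/
lemma besselJ_half_int_eq (l : ℕ) {a : ℝ} (ha : 0 < a) :
    (2 * Real.pi) ^ (3 / 2 : ℝ) * (besselJ ((l : ℝ) + 1 / 2) a / Real.sqrt a) =
      4 * Real.pi * sphBessel l a := by
  have hpi := Real.pi_pos
  rw [besselJ, sphBessel, ← tsum_div_const, ← tsum_mul_left, ← tsum_mul_left]
  congr 1
  ext k
  have h1 : (k : ℝ) + ((l : ℝ) + 1 / 2) + 1 = ((l + k : ℕ) : ℝ) + 3 / 2 := by push_cast; ring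
  have h2 : (a / 2) ^ (2 * (k : ℝ) + ((l : ℝ) + 1 / 2)) =
      (a / 2) ^ (l + 2 * k) * (Real.sqrt a / Real.sqrt 2) := by
    rw [show 2 * (k : ℝ) + ((l : ℝ) + 1 / 2) = ((l + 2 * k : ℕ) : ℝ) + 1 / 2 by push_cast; ring,
      Real.rpow_add (by positivity), Real.rpow_natCast, ← Real.sqrt_eq_rpow, Real.sqrt_div ha.le]
  have h3 : (2 * Real.pi) ^ (3 / 2 : ℝ) = 2 * Real.pi * (Real.sqrt 2 * Real.sqrt Real.pi) := by
    rw [show (3 / 2 : ℝ) = 1 + 1 / 2 by norm_num, Real.rpow_add (by positivity), Real.rpow_one,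
      ← Real.sqrt_eq_rpow, Real.sqrt_mul (by norm_num)]
  rw [h1, h2, h3, Gamma_nat_add_three_halves]
  have e1 : Real.sqrt a ≠ 0 := (Real.sqrt_pos.2 ha).ne'
  have e2 : Real.sqrt 2 ≠ 0 := by positivity
  have e3 : Real.sqrt Real.pi ≠ 0 := (Real.sqrt_pos.2 hpi).ne'
  rw [div_pow, show 2 * (l + k) + 1 = 2 * l + 2 * k + 1 by ring,
    show (2 : ℝ) ^ (2 * l + 2 * k + 1) = 2 ^ (l + 2 * k) * 2 ^ l * 2 by ring]
  field_simp
  ring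

/-! ### Closed form of the coupling coefficients. -/

lemma norm_dir (φ θ : ℝ) : ‖dir φ θ‖ = 1 := by
  rw [EuclideanSpace.norm_eq, Real.sqrt_eq_one, Fin.sum_univ_three]
  simp [dir, mul_pow]
  linear_combination Real.sin θ ^ 2 * Real.sin_sq_add_cos_sq φ + Real.sin_sq_add_cos_sq θ

lemma norm_mul_cos_angle_dir (x : Space) (φ θ : ℝ) :
    ‖x‖ * Real.cos (InnerProductGeometry.angle x (dir φ θ)) = inner ℝ x (dir φ θ) := by
  have h := InnerProductGeometry.cos_angle_mul_norm_mul_norm x (dir φ θ)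
  rw [norm_dir] at h
  linarith

lemma inner_dir (x : Space) (φ θ : ℝ) :
    ((inner ℝ x (dir φ θ) : ℝ) : ℂ) = dirForm (fun i => (x i : ℂ)) φ θ := by
  rw [PiLp.inner_apply, Fin.sum_univ_three]
  simp [dir, dirForm]
  ring

lemma coupling_eq_inner {U : ℕ} (lam : ℝ) (X : Fin U → Space) (u k : Fin U) (m : ℤ) (l : ℕ) :
    coupling lam X u k m l = sphereIntegral (fun φ θ => Complex.exp (Complex.I *
      ((2 * Real.pi / lam * (inner ℝ (X u) (dir φ θ) - inner ℝ (X k) (dir φ θ)) : ℝ) : ℂ)) *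
      sphericalHarmonic l m φ θ) := by
  simp only [coupling, norm_mul_cos_angle_dir]

/-- Allowing any real `b` covers distinct and coincident users by one formula. -/
lemma coupling_eq_of_sub_eq {U : ℕ} (lam : ℝ) (X : Fin U → Space) (u k : Fin U) {m : ℤ} {l : ℕ}
    (hm : -(l : ℤ) ≤ m) (hm' : m ≤ l) {b φ₀ θ₀ : ℝ} (hθ₀ : θ₀ ∈ Set.Icc 0 Real.pi)
    (h : X u - X k = b • dir φ₀ θ₀) :
    coupling lam X u k m l = 4 * Real.pi * Complex.I ^ l * sphBessel l (2 * Real.pi / lam * b) *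
      sphericalHarmonic l m φ₀ θ₀ := by
  rw [← sphereIntegral_sphericalHarmonic_mul_exp hm hm' _ _ hθ₀, coupling_eq_inner]
  congr 1
  ext φ θ
  rw [← inner_sub_left, h, Complex.ofReal_mul, inner_dir]
  congr 3
  simp [dirForm]
  ring

lemma coupling_of_eq {U : ℕ} (lam : ℝ) (X : Fin U → Space) (u k : Fin U) {m : ℤ} {l : ℕ}
    (hm : -(l : ℤ) ≤ m) (hm' : m ≤ l) (h : X u = X k) :
    coupling lam X u k m l = if l = 0 then ((Real.sqrt (4 * Real.pi) : ℝ) : ℂ) else 0 := by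
  -- With `b = 0` the direction is arbitrary; the north pole is taken.
  rw [coupling_eq_of_sub_eq lam X u k hm hm' (b := 0) (φ₀ := 0) (θ₀ := 0)
    ⟨le_rfl, Real.pi_pos.le⟩ (by simp [h]), mul_zero]
  have hS : sphBessel l 0 = if l = 0 then 1 else 0 := by
    rw [sphBessel, tsum_eq_single 0]
    · split_ifs with h0
      · simp [h0]
      · simp [h0]
    · intro p hp
      simp [hp]
  rw [hS]
  split_ifs with h0
  · subst h0
    obtain rfl : m = 0 := by simp at hm hm'; omega
    have hq : Real.sqrt (4 * Real.pi) ≠ 0 := (Real.sqrt_pos.2 (by positivity)).ne'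
    have e : (4 * Real.pi : ℝ) = Real.sqrt (4 * Real.pi) * Real.sqrt (4 * Real.pi) :=
      (Real.mul_self_sqrt (by positivity)).symm
    have hY : sphericalHarmonic 0 0 0 0 = ((1 / Real.sqrt (4 * Real.pi) : ℝ) : ℂ) := by
      simp [sphericalHarmonic, assocLegendre]
    rw [hY, pow_zero, mul_one, Complex.ofReal_one, mul_one,
      show (4 * Real.pi : ℂ) = ((4 * Real.pi : ℝ) : ℂ) by push_cast; rfl, ← Complex.ofReal_mul]
    congr 1
    rw [mul_one_div, div_eq_iff hq, ← e]
  · simp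

lemma coupling_of_ne {U : ℕ} {lam : ℝ} (hlam : 0 < lam) (X : Fin U → Space) (u k : Fin U) {m : ℤ}
    {l : ℕ} (hm : -(l : ℤ) ≤ m) (hm' : m ≤ l) (hne : X u ≠ X k) {φ θ : ℝ}
    (hθ : θ ∈ Set.Icc 0 Real.pi) (h : X u - X k = ‖X u - X k‖ • dir φ θ) :
    coupling lam X u k m l =
          (((2 * Real.pi) ^ (3 / 2 : ℝ) : ℝ) : ℂ) * Complex.I ^ l *
            ((besselJ ((l : ℝ) + 1 / 2) (2 * Real.pi / lam * ‖X u - X k‖) /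
              Real.sqrt (2 * Real.pi / lam * ‖X u - X k‖) : ℝ) : ℂ) *
            sphericalHarmonic l m φ θ := by
  rw [coupling_eq_of_sub_eq lam X u k hm hm' hθ h]
  have h0 : 0 < 2 * Real.pi / lam * ‖X u - X k‖ :=
    mul_pos (div_pos Real.two_pi_pos hlam) (norm_pos_iff.2 (sub_ne_zero.2 hne))
  have h1 := congrArg (fun x : ℝ => (x : ℂ)) (besselJ_half_int_eq l h0)
  simp only [Complex.ofReal_mul (_ : ℝ) (_ / _), Complex.ofReal_mul (4 * Real.pi)] at h1
  push_cast at h1 ⊢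
  linear_combination (-(Complex.I ^ l * sphericalHarmonic l m φ θ)) * h1

/-! ### Asymptotics for a large array. -/

@[fun_prop]
lemma continuous_dir : Continuous fun p : ℝ × ℝ => dir p.1 p.2 := by
  unfold dir
  fun_prop

/-- The continuous version of the superposition of phase modes. -/
noncomputable def modeSum {M : ℕ} (c : ModeIndex M → ℂ) (φ θ : ℝ) : ℂ :=
  ∑ ℓ : Fin (M + 1), ∑ m : ↥(Finset.Icc (-((ℓ : ℕ) : ℤ)) ((ℓ : ℕ) : ℤ)),
    c ⟨ℓ, m⟩ * (harmonicConst ℓ m * (harmonicPoly ℓ φ θ).coeff (ℓ + m : ℤ).toNat)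

lemma continuous_modeSum {M : ℕ} (c : ModeIndex M → ℂ) :
    Continuous fun p : ℝ × ℝ => modeSum c p.1 p.2 := by
  unfold modeSum
  refine continuous_finsetSum _ fun ℓ _ => continuous_finsetSum _ fun m _ => ?_
  have := continuous_coeff_harmonicPoly ℓ (ℓ + m : ℤ).toNat
  fun_prop

lemma modeSum_eq {M : ℕ} (c : ModeIndex M → ℂ) (φ : ℝ) {θ : ℝ} (hθ : θ ∈ Set.Icc 0 Real.pi) :
    modeSum c φ θ =
      ∑ ℓ : Fin (M + 1), ∑ m : ↥(Finset.Icc (-((ℓ : ℕ) : ℤ)) ((ℓ : ℕ) : ℤ)),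
        c ⟨ℓ, m⟩ * sphericalHarmonic ℓ m φ θ := by
  refine Finset.sum_congr rfl fun ℓ _ => Finset.sum_congr rfl fun m _ => ?_
  rw [sphericalHarmonic_eq_coeff (Finset.mem_Icc.1 m.2).1 φ hθ]

lemma exists_norm_modeSum_le {M : ℕ} (c : ModeIndex M → ℂ) :
    ∃ B, ∀ φ ∈ Set.Icc 0 (2 * Real.pi), ∀ θ ∈ Set.Icc 0 Real.pi, ‖modeSum c φ θ‖ ≤ B := by
  obtain ⟨B, hB⟩ := ((isCompact_Icc (a := (0 : ℝ)) (b := 2 * Real.pi)).prod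
    (isCompact_Icc (a := (0 : ℝ)) (b := Real.pi))).exists_bound_of_continuousOn
      (continuous_modeSum c).continuousOn
  exact ⟨B, fun φ hφ θ hθ => hB (φ, θ) ⟨hφ, hθ⟩⟩

/-- The far-field phase factor between users at `x` and `y`. -/
noncomputable def farFactor (lam : ℝ) (x y : Space) (φ θ : ℝ) : ℂ :=
  Complex.exp (Complex.I *
    ((2 * Real.pi / lam * (inner ℝ x (dir φ θ) - inner ℝ y (dir φ θ)) : ℝ) : ℂ))

/-- The normalized product of channel and precoder on the array of radius `r`. -/
noncomputable def nearFactor (lam : ℝ) (x y : Space) (r φ θ : ℝ) : ℂ :=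
  ((r / ‖x - r • dir φ θ‖ : ℝ) : ℂ) * Complex.exp (Complex.I *
    ((2 * Real.pi / lam * (‖y - r • dir φ θ‖ - ‖x - r • dir φ θ‖) : ℝ) : ℂ))

lemma continuous_farFactor (lam : ℝ) (x y : Space) :
    Continuous fun p : ℝ × ℝ => farFactor lam x y p.1 p.2 := by
  unfold farFactor
  fun_prop

lemma norm_sub_smul_dir_pos {x : Space} {r : ℝ} (hr : ‖x‖ < r) (φ θ : ℝ) :
    0 < ‖x - r • dir φ θ‖ := by
  have h1 := norm_sub_norm_le (r • dir φ θ) x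
  rw [norm_smul, norm_dir, mul_one, Real.norm_eq_abs, norm_sub_rev] at h1
  have := le_abs_self r
  linarith

lemma continuous_nearFactor (lam : ℝ) {x : Space} (y : Space) {r : ℝ} (hr : ‖x‖ < r) :
    Continuous fun p : ℝ × ℝ => nearFactor lam x y r p.1 p.2 := by
  unfold nearFactor
  have h : ∀ p : ℝ × ℝ, ‖x - r • dir p.1 p.2‖ ≠ 0 := fun p => (norm_sub_smul_dir_pos hr _ _).ne'
  refine Continuous.mul ?_ (by fun_prop)
  refine Complex.continuous_ofReal.comp (Continuous.div (by fun_prop) (by fun_prop) h)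

/-- Puts the leading term under a single sphere integral, so that it can be compared pointwise with
the exact gain. -/
lemma sum_mul_coupling {U M : ℕ} (lam : ℝ) (X : Fin U → Space) (u k : Fin U)
    (c : ModeIndex M → ℂ) :
    ∑ ℓ : Fin (M + 1), ∑ m : ↥(Finset.Icc (-((ℓ : ℕ) : ℤ)) ((ℓ : ℕ) : ℤ)),
        c ⟨ℓ, m⟩ * coupling lam X u k m ℓ =
      sphereIntegral fun φ θ => farFactor lam (X u) (X k) φ θ * modeSum c φ θ := by
  have hf := continuous_farFactor lam (X u) (X k)
  have h1 : ∀ φ θ, farFactor lam (X u) (X k) φ θ * modeSum c φ θ =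
      ∑ ℓ : Fin (M + 1), ∑ m : ↥(Finset.Icc (-((ℓ : ℕ) : ℤ)) ((ℓ : ℕ) : ℤ)),
        c ⟨ℓ, m⟩ * (farFactor lam (X u) (X k) φ θ *
          (harmonicConst ℓ m * (harmonicPoly ℓ φ θ).coeff (ℓ + m : ℤ).toNat)) := by
    intro φ θ
    simp only [modeSum, Finset.mul_sum]
    refine Finset.sum_congr rfl fun ℓ _ => Finset.sum_congr rfl fun m _ => ?_
    ring
  have h2 : ∀ (ℓ : Fin (M + 1)) (m : ↥(Finset.Icc (-((ℓ : ℕ) : ℤ)) ((ℓ : ℕ) : ℤ))),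
      Continuous fun p : ℝ × ℝ => c ⟨ℓ, m⟩ * (farFactor lam (X u) (X k) p.1 p.2 *
          (harmonicConst ℓ m * (harmonicPoly ℓ p.1 p.2).coeff (ℓ + m : ℤ).toNat)) := by
    intro ℓ m
    have := continuous_coeff_harmonicPoly ℓ (ℓ + m : ℤ).toNat
    fun_prop
  simp only [h1]
  rw [sphereIntegral_finsetSum]
  · refine Finset.sum_congr rfl fun ℓ _ => ?_
    rw [sphereIntegral_finsetSum]
    · refine Finset.sum_congr rfl fun m _ => ?_
      rw [sphereIntegral_const_mul, coupling_eq_inner]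
      congr 1
      refine sphereIntegral_congr fun φ θ hθ => ?_
      rw [sphericalHarmonic_eq_coeff (Finset.mem_Icc.1 m.2).1 φ hθ, farFactor]
    · exact fun m _ => h2 ℓ m
  · exact fun ℓ _ => continuous_finsetSum _ fun m _ => h2 ℓ m

lemma conjPrecoder_eq {lam : ℝ} {y a : Space} (h : 0 < ‖y - a‖) :
    conjPrecoder lam y a =
      Complex.exp (Complex.I * ((2 * Real.pi / lam * ‖y - a‖ : ℝ) : ℂ)) := by
  have hpi := Real.pi_pos
  have hD : 0 < Real.sqrt (4 * Real.pi) * ‖y - a‖ := mul_pos (Real.sqrt_pos.2 (by positivity)) h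
  have hn : ‖channel lam y a‖ = 1 / (Real.sqrt (4 * Real.pi) * ‖y - a‖) := by
    rw [channel, norm_mul, neg_mul, mul_comm Complex.I, ← neg_mul, ← Complex.ofReal_neg,
      Complex.norm_exp_ofReal_mul_I, mul_one, norm_div, norm_one, Complex.norm_real,
      Real.norm_eq_abs, abs_of_pos hD]
  rw [conjPrecoder, hn, channel, map_mul, ← Complex.exp_conj]
  simp only [map_div₀, map_mul, map_neg, map_one, Complex.conj_I, Complex.conj_ofReal, neg_neg]
  have hD' : ((Real.sqrt (4 * Real.pi) * ‖y - a‖ : ℝ) : ℂ) ≠ 0 := by exact_mod_cast hD.ne'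
  rw [Complex.ofReal_div, Complex.ofReal_one, mul_comm, mul_div_assoc,
    div_self (one_div_ne_zero hD'), mul_one]

lemma streamGain_eq {M : ℕ} (lam Pt : ℝ) {x y : Space} (c : ModeIndex M → ℂ) {r : ℝ}
    (hx : ‖x‖ < r) (hy : ‖y‖ < r) :
    streamGain lam Pt x y c r =
      ((lam * Real.sqrt (Pt / (4 * Real.pi)) * (1 / (4 * Real.pi)) : ℝ) : ℂ) *
        sphereIntegral fun φ θ => nearFactor lam x y r φ θ * modeSum c φ θ := by
  have hpi := Real.pi_pos
  have hr : 0 < r := (norm_nonneg x).trans_lt hx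
  -- One factor of `r²` normalizes `1/D` to `r/D`; the other cancels the `1/r` from the power
  -- normalization.
  have h1 : sphereIntegral (fun φ θ =>
      channel lam x (r • dir φ θ) * phaseModePrecoder lam y c r φ θ * ((r ^ 2 : ℝ) : ℂ)) =
      ((r / Real.sqrt (4 * Real.pi) : ℝ) : ℂ) *
        sphereIntegral fun φ θ => nearFactor lam x y r φ θ * modeSum c φ θ := by
    rw [← sphereIntegral_const_mul]
    refine sphereIntegral_congr fun φ θ hθ => ?_
    have hDx := norm_sub_smul_dir_pos hx φ θ
    have hDy := norm_sub_smul_dir_pos hy φ θ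
    rw [phaseModePrecoder, ← modeSum_eq c φ hθ, conjPrecoder_eq hDy, channel, nearFactor]
    set Dx := ‖x - r • dir φ θ‖
    set Dy := ‖y - r • dir φ θ‖
    have he : Complex.exp (Complex.I * ((2 * Real.pi / lam * (Dy - Dx) : ℝ) : ℂ)) =
        Complex.exp (-Complex.I * ((2 * Real.pi / lam * Dx : ℝ) : ℂ)) *
          Complex.exp (Complex.I * ((2 * Real.pi / lam * Dy : ℝ) : ℂ)) := by
      rw [← Complex.exp_add]
      congr 1
      push_cast
      ring
    rw [he]
    push_cast
    ring
  rw [streamGain, h1, ← mul_assoc, ← Complex.ofReal_mul]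
  congr 2
  have hs : Real.sqrt (Pt / (4 * Real.pi * r ^ 2)) = Real.sqrt (Pt / (4 * Real.pi)) / r := by
    rw [← div_div, Real.sqrt_div' _ (by positivity), Real.sqrt_sq hr.le]
  have hq : Real.sqrt (4 * Real.pi) ≠ 0 := (Real.sqrt_pos.2 (by positivity)).ne'
  have hq2 : Real.sqrt (4 * Real.pi) * Real.sqrt (4 * Real.pi) = 4 * Real.pi :=
    Real.mul_self_sqrt (by positivity)
  have e : lam / Real.sqrt (4 * Real.pi) * (Real.sqrt (Pt / (4 * Real.pi)) / r) *
      (r / Real.sqrt (4 * Real.pi)) = lam * Real.sqrt (Pt / (4 * Real.pi)) *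
        (1 / (Real.sqrt (4 * Real.pi) * Real.sqrt (4 * Real.pi))) := by
    field_simp
  rw [hs, e, hq2]

/-- The difference of squares `D² - (r - i)²` equals `‖x‖² - i²`, which lies in `[0, R²]`; divide by
`D + (r - i) ≥ r/2`. -/
lemma abs_norm_sub_smul_dir_sub_le {x : Space} {R r : ℝ} (hx : ‖x‖ ≤ R) (hr : 0 < r)
    (hR : 2 * R ≤ r) (φ θ : ℝ) :
    |‖x - r • dir φ θ‖ - (r - inner ℝ x (dir φ θ))| ≤ 2 * R ^ 2 / r := by
  set D := ‖x - r • dir φ θ‖ with hD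
  set i := inner ℝ x (dir φ θ) with hi
  have hDsq : D ^ 2 = ‖x‖ ^ 2 - 2 * (r * i) + r ^ 2 := by
    rw [hD, norm_sub_sq_real, real_inner_smul_right, norm_smul, norm_dir, mul_one,
      Real.norm_eq_abs, sq_abs]
  have hile : |i| ≤ ‖x‖ := by
    have := abs_real_inner_le_norm x (dir φ θ)
    rwa [norm_dir, mul_one] at this
  have hisq : i ^ 2 ≤ ‖x‖ ^ 2 := sq_le_sq' (abs_le.1 hile).1 (abs_le.1 hile).2
  have hxsq : ‖x‖ ^ 2 ≤ R ^ 2 := pow_le_pow_left₀ (norm_nonneg _) hx 2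
  have hlow : r / 2 ≤ D + (r - i) := by
    have := (abs_le.1 hile).2
    have : 0 ≤ D := norm_nonneg _
    linarith
  have hprod : (D - (r - i)) * (D + (r - i)) = ‖x‖ ^ 2 - i ^ 2 := by linear_combination hDsq
  have h0 : 0 ≤ D - (r - i) := by
    by_contra! h
    have := mul_neg_of_neg_of_pos h (show 0 < D + (r - i) by linarith)
    linarith
  rw [abs_of_nonneg h0, le_div_iff₀ hr]
  have := mul_le_mul_of_nonneg_left hlow h0
  nlinarith [sq_nonneg i]

/-- The amplitude error is at most `2R/r` because `D ≥ r/2`. The phase error is `κ` times two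
distance errors of `2R²/r` each. -/
lemma norm_nearFactor_sub_farFactor_le {lam : ℝ} (hlam : 0 < lam) {x y : Space} {R r : ℝ}
    (hx : ‖x‖ ≤ R) (hy : ‖y‖ ≤ R) (hr : 0 < r) (hR : 2 * R ≤ r) (φ θ : ℝ) :
    ‖nearFactor lam x y r φ θ - farFactor lam x y φ θ‖ ≤
      (2 + 2 * Real.pi / lam * (4 * R)) * (R / r) := by
  have hpx := abs_norm_sub_smul_dir_sub_le hx hr hR φ θ
  have hpy := abs_norm_sub_smul_dir_sub_le hy hr hR φ θ
  have hxr : ‖x‖ < r := by linarith [norm_nonneg x]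
  have hDpos := norm_sub_smul_dir_pos hxr φ θ
  have habs : |‖x - r • dir φ θ‖ - r| ≤ ‖x‖ := by
    have := abs_norm_sub_norm_le (x - r • dir φ θ) (-(r • dir φ θ))
    rwa [sub_neg_eq_add, sub_add_cancel, norm_neg, norm_smul, norm_dir, mul_one, Real.norm_eq_abs,
      abs_of_pos hr] at this
  rw [nearFactor, farFactor]
  set D := ‖x - r • dir φ θ‖
  set E := ‖y - r • dir φ θ‖
  set i := inner ℝ x (dir φ θ)
  set j := inner ℝ y (dir φ θ)
  set κ := 2 * Real.pi / lam
  have hκ : 0 < κ := div_pos Real.two_pi_pos hlam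
  have hDr : r / 2 ≤ D := by linarith [(abs_le.1 habs).1]
  have h1 : |r / D - 1| ≤ 2 * (R / r) := by
    rw [div_sub_one hDpos.ne', abs_div, abs_of_pos hDpos, abs_sub_comm, div_le_iff₀ hDpos]
    calc |D - r| ≤ R := habs.trans hx
      _ = 2 * (R / r) * (r / 2) := by field_simp
      _ ≤ 2 * (R / r) * D := by
        have : 0 ≤ R := (norm_nonneg x).trans hx
        gcongr
  have h2 : ‖Complex.exp (Complex.I * ((κ * (E - D) : ℝ) : ℂ)) -
      Complex.exp (Complex.I * ((κ * (i - j) : ℝ) : ℂ))‖ ≤ κ * (4 * R) * (R / r) := by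
    have e : Complex.exp (Complex.I * ((κ * (E - D) : ℝ) : ℂ)) -
      Complex.exp (Complex.I * ((κ * (i - j) : ℝ) : ℂ)) =
      Complex.exp (Complex.I * ((κ * (i - j) : ℝ) : ℂ)) *
        (Complex.exp (Complex.I * ((κ * (E - D) - κ * (i - j) : ℝ) : ℂ)) - 1) := by
      rw [mul_sub (Complex.exp _), ← Complex.exp_add, mul_one]
      congr 2
      push_cast
      ring
    rw [e, norm_mul, Complex.norm_exp_I_mul_ofReal, one_mul]
    refine (Real.norm_exp_I_mul_ofReal_sub_one_le).trans ?_
    rw [← mul_sub, norm_mul, Real.norm_eq_abs, Real.norm_eq_abs, abs_of_pos hκ, mul_assoc κ]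
    refine mul_le_mul_of_nonneg_left ?_ hκ.le
    have e2 : E - D - (i - j) = (E - (r - j)) - (D - (r - i)) := by ring
    rw [e2]
    refine (abs_sub _ _).trans ((add_le_add hpy hpx).trans_eq (by ring))
  have e3 : ((r / D : ℝ) : ℂ) * Complex.exp (Complex.I * ((κ * (E - D) : ℝ) : ℂ)) -
      Complex.exp (Complex.I * ((κ * (i - j) : ℝ) : ℂ)) =
      ((r / D - 1 : ℝ) : ℂ) * Complex.exp (Complex.I * ((κ * (E - D) : ℝ) : ℂ)) +
        (Complex.exp (Complex.I * ((κ * (E - D) : ℝ) : ℂ)) -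
          Complex.exp (Complex.I * ((κ * (i - j) : ℝ) : ℂ))) := by
    push_cast
    ring
  rw [e3]
  refine (norm_add_le _ _).trans ?_
  rw [norm_mul, Complex.norm_exp_I_mul_ofReal, mul_one, Complex.norm_real, Real.norm_eq_abs,
    add_mul]
  exact add_le_add h1 h2

lemma streamGain_sub_isBigO {U M : ℕ} {lam : ℝ} (hlam : 0 < lam) (Pt : ℝ) (X : Fin U → Space)
    (u k : Fin U) (c : ModeIndex M → ℂ) :
    (fun r₀ : ℝ => streamGain lam Pt (X u) (X k) c r₀ -
          ((lam * Real.sqrt (Pt / (4 * Real.pi)) * (1 / (4 * Real.pi)) : ℝ) : ℂ) *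
            ∑ ℓ : Fin (M + 1), ∑ m : ↥(Finset.Icc (-((ℓ : ℕ) : ℤ)) ((ℓ : ℕ) : ℤ)),
              c ⟨ℓ, m⟩ * coupling lam X u k m ℓ)
        =O[atTop] (fun r₀ : ℝ => (⨆ v : Fin U, ‖X v‖) / r₀) := by
  obtain ⟨B, hB⟩ := exists_norm_modeSum_le c
  set R := ⨆ v : Fin U, ‖X v‖
  have hle : ∀ v, ‖X v‖ ≤ R := fun v =>
    le_ciSup (f := fun v => ‖X v‖) (Set.finite_range _).bddAbove v
  set K : ℂ := ((lam * Real.sqrt (Pt / (4 * Real.pi)) * (1 / (4 * Real.pi)) : ℝ) : ℂ)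
  refine IsBigO.of_bound (‖K‖ * ((2 + 2 * Real.pi / lam * (4 * R)) * B * (2 * Real.pi ^ 2))) ?_
  filter_upwards [eventually_gt_atTop 0, eventually_ge_atTop (2 * R)] with r hr hR
  have hlt : ∀ v, ‖X v‖ < r := fun v => by linarith [hle v, norm_nonneg (X v)]
  have hR0 : 0 ≤ R := (norm_nonneg _).trans (hle u)
  have hm := continuous_modeSum c
  have hf := continuous_farFactor lam (X u) (X k)
  have hn := continuous_nearFactor lam (X k) (hlt u)
  rw [streamGain_eq lam Pt c (hlt u) (hlt k), sum_mul_coupling, ← mul_sub, norm_mul,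
    ← sphereIntegral_sub (F := fun φ θ => nearFactor lam (X u) (X k) r φ θ * modeSum c φ θ)
      (G := fun φ θ => farFactor lam (X u) (X k) φ θ * modeSum c φ θ) (hn.mul hm) (hf.mul hm),
    Real.norm_of_nonneg (div_nonneg hR0 hr.le)]
  rw [mul_assoc ‖K‖]
  refine mul_le_mul_of_nonneg_left ?_ (norm_nonneg K)
  refine (norm_sphereIntegral_le
    (C := (2 + 2 * Real.pi / lam * (4 * R)) * (R / r) * B) ?_).trans_eq (by ring)
  intro φ hφ θ hθ
  rw [← sub_mul, norm_mul]
  have h1 := norm_nearFactor_sub_farFactor_le hlam (hle u) (hle k) hr hR φ θ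
  exact mul_le_mul h1 (hB φ hφ θ hθ) (norm_nonneg _) ((norm_nonneg _).trans h1)

/-! ### Zero forcing and the null space. -/

lemma zeroForcing_iff_mem_ker {U M : ℕ} (lam : ℝ) (X : Fin U → Space) (u : Fin U)
    (c : ModeIndex M → ℂ) :
    ZeroForcing lam X u c ↔ c ∈ LinearMap.ker (couplingMatrix M lam X u).mulVecLin := by
  rw [LinearMap.mem_ker, Matrix.mulVecLin_apply, funext_iff, Subtype.forall, ZeroForcing]
  refine forall₂_congr fun k hk => ?_
  rw [Matrix.mulVec, dotProduct, Fintype.sum_sigma]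
  simp only [couplingMatrix, couplingBlock, Matrix.of_apply, Pi.zero_apply, mul_comm (c _)]

lemma interference_isBigO_iff_zeroForcing {U M : ℕ} {lam Pt : ℝ} (hlam : 0 < lam) (hPt : 0 < Pt)
    (X : Fin U → Space) (u : Fin U) (c : ModeIndex M → ℂ) :
    (∀ k : Fin U, k ≠ u → (fun r₀ : ℝ => streamGain lam Pt (X k) (X u) c r₀)
          =O[atTop] (fun r₀ : ℝ => (⨆ v : Fin U, ‖X v‖) / r₀)) ↔ ZeroForcing lam X u c := by
  refine forall₂_congr fun k _ => ?_
  have h := streamGain_sub_isBigO hlam Pt X k u c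
  constructor
  · intro h1
    -- The difference is the leading term, constant in `r₀`; being `O(R/r₀)` it tends to zero, so it
    -- is zero.
    have h2 := h1.sub h
    simp only [sub_sub_cancel] at h2
    have h3 : Tendsto (fun r₀ : ℝ => (⨆ v : Fin U, ‖X v‖) / r₀) atTop (𝓝 0) :=
      tendsto_const_nhds.div_atTop tendsto_id
    have h4 := tendsto_nhds_unique tendsto_const_nhds (h2.trans_tendsto h3)
    refine (mul_eq_zero.1 h4).resolve_left ?_
    have hpi := Real.pi_pos
    have : 0 < Real.sqrt (Pt / (4 * Real.pi)) := Real.sqrt_pos.2 (by positivity)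
    exact_mod_cast (by positivity : lam * Real.sqrt (Pt / (4 * Real.pi)) * (1 / (4 * Real.pi)) ≠ 0)
  · intro h1
    simpa only [h1, mul_zero, sub_zero] using h

end UbiquitousArray

theorem mainTheorem8 (U M : ℕ) (lam Pt : ℝ) (hlam : 0 < lam) (hPt : 0 < Pt)
    (X : Fin U → EuclideanSpace ℝ (Fin 3)) :
    -- closed form of the coupling coefficients
    (∀ (u k : Fin U) (ℓ : ℕ) (m : ℤ), -(ℓ : ℤ) ≤ m → m ≤ (ℓ : ℤ) → X u ≠ X k →
      ∀ φ θ : ℝ, θ ∈ Set.Icc 0 Real.pi → X u - X k = ‖X u - X k‖ • dir φ θ →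
        coupling lam X u k m ℓ =
          (((2 * Real.pi) ^ (3 / 2 : ℝ) : ℝ) : ℂ) * Complex.I ^ ℓ *
            ((besselJ ((ℓ : ℝ) + 1 / 2) (2 * Real.pi / lam * ‖X u - X k‖) /
              Real.sqrt (2 * Real.pi / lam * ‖X u - X k‖) : ℝ) : ℂ) *
            sphericalHarmonic ℓ m φ θ) ∧
    -- coupling coefficients at coincident points (in particular for `u = k`)
    (∀ (u k : Fin U) (ℓ : ℕ) (m : ℤ), -(ℓ : ℤ) ≤ m → m ≤ (ℓ : ℤ) → X u = X k →
      coupling lam X u k m ℓ = if ℓ = 0 then ((Real.sqrt (4 * Real.pi) : ℝ) : ℂ) else 0) ∧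
    -- the signal of user `k` received at user `u`, for a large array
    (∀ (u k : Fin U) (c : ModeIndex M → ℂ),
      (fun r₀ : ℝ => streamGain lam Pt (X u) (X k) c r₀ -
          ((lam * Real.sqrt (Pt / (4 * Real.pi)) * (1 / (4 * Real.pi)) : ℝ) : ℂ) *
            ∑ ℓ : Fin (M + 1), ∑ m : ↥(Finset.Icc (-((ℓ : ℕ) : ℤ)) ((ℓ : ℕ) : ℤ)),
              c ⟨ℓ, m⟩ * coupling lam X u k m ℓ)
        =O[Filter.atTop] (fun r₀ : ℝ => (⨆ v : Fin U, ‖X v‖) / r₀)) ∧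
    -- the zero-forcing coefficients are those in the null space
    (∀ (u : Fin U) (c : ModeIndex M → ℂ),
      ZeroForcing lam X u c ↔ c ∈ LinearMap.ker (couplingMatrix M lam X u).mulVecLin) ∧
    -- and these are the coefficients without interference up to `O(max r_v / r₀)`
    (∀ (u : Fin U) (c : ModeIndex M → ℂ),
      (∀ k : Fin U, k ≠ u → (fun r₀ : ℝ => streamGain lam Pt (X k) (X u) c r₀)
          =O[Filter.atTop] (fun r₀ : ℝ => (⨆ v : Fin U, ‖X v‖) / r₀)) ↔
        c ∈ LinearMap.ker (couplingMatrix M lam X u).mulVecLin) :=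
  ⟨fun _ _ _ _ hm hm' hne _ _ hθ h => coupling_of_ne hlam X _ _ hm hm' hne hθ h,
    fun _ _ _ _ hm hm' h => coupling_of_eq lam X _ _ hm hm' h,
    streamGain_sub_isBigO hlam Pt X,
    zeroForcing_iff_mem_ker lam X,
    fun u c => (interference_isBigO_iff_zeroForcing hlam hPt X u c).trans
      (zeroForcing_iff_mem_ker lam X u c)⟩
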